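/- **Conventions.** All fields have characteristic zero; rings are commutative with $1$. A difference ring is a ring with an automorphism $\sigma$, its constants are $C_R=\{x\in R:\sigma(x)=x\}$, and difference ring extensions and homomorphisms are compatible with $\sigma$. Let $K$ be a difference field and $A\in\mathrm{GL}_n(K)$. A *Picard-Vessiot ring* for $\sigma Y=AY$ over $K$ is a difference ring extension $R=K[Z,1/\det Z]$ of $K$ with $Z\in\mathrm{GL}_n(R)$, $\sigma Z=AZ$, which is nonzero and has no $\sigma$-invariant ideals other than $0$ and $R$. A *weak Picard-Vessiot ring* is a nonzero difference ring extension of the same form $R=K[Z,1/\det Z]$ with $C_R=C_K$ in place of the condition on ideals. A *weak Picard-Vessiot field* is a difference field extension $L$ of $K$ with $C_L=C_K$ that is the quotient field of a weak Picard-Vessiot ring. For a difference ring extension $R$ of $K$, the *Galois group* $G_R$ is the group functor on $C_K$-algebras that sends $B$ to the group of $K\otimes_{C_K}B$-linear automorphisms of $R\otimes_{C_K}B$ commuting with $\sigma$, where $\sigma(r\otimes b)=\sigma(r)\otimes b$. **Theorem.** Let $k$ be a difference field whose field of constants $C=C_k$ is algebraically closed, let $A\in\mathrm{GL}_n(k)$,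 and let $R$ be a Picard-Vessiot ring for $\sigma Y=AY$ over $k$. Let $K$ be a difference field extension of $k$ with $K=k(C_K)$, let $\overline{C}_K$ be an algebraic closure of $C_K$, and let $L$ be a weak Picard-Vessiot field for $\sigma Y=AY$ over $K$, written $L=K(V)$ with $V\in\mathrm{GL}_n(L)$ and $\sigma V=AV$. Put $T=K[V,1/\det V]\subset L$. Then: (a) There is an isomorphism of rings $$\Phi:\ (K\otimes_k R)\otimes_{C_K}\overline{C}_K\ \xrightarrow{\ \sim\ }\ T\otimes_{C_K}\overline{C}_K$$ which is linear over $K$ and over $\overline{C}_K$ and commutes with $\sigma$ (acting on $K\otimes_k R$ by $\sigma\otimes\sigma$ and trivially on $\overline{C}_K$). Moreover, $r\otimes c\mapsto\Phi((1\otimes r)\otimes c)$ is an injective ring homomorphism $R\otimes_C\overline{C}_K\to T\otimes_{C_K}\overline{C}_K$. Furthermore, $T$ is a Picard-Vessiot ring for $\sigma Y=AY$ over $K$. (b) The Galois groups $G_R$ of $R$ over $k$ and $G_T$ of $T$ over $K$ are linear algebraic groups over $C$ and over $C_K$ respectively (that is, they are represented by finitely generated algebras), and they become isomorphic over $\overline{C}_K$: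 $G_R\times_C\overline{C}_K\simeq G_T\times_{C_K}\overline{C}_K$. -/

import Mathlib

open TensorProduct CategoryTheory

universe u

/-- A difference ring: a commutative ring with a distinguished automorphism `σ`. -/
class DifferenceRing (R : Type*) [CommRing R] where
  /-- the automorphism -/
  σ : R ≃+* R

namespace DifferenceRing

/-- A difference ring extension: the structure map commutes with the automorphisms. -/
class Extension (K R : Type*) [CommRing K] [CommRing R] [DifferenceRing K] [DifferenceRing R]
    [Algebra K R] : Prop where
  σ_algebraMap : ∀ a : K, σ (algebraMap K R a) = algebraMap K R (σ a)

/-- `R` is simple as a difference ring: `0` and `R` are its only `σ`-invariant ideals. -/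
def IsSimple (R : Type*) [CommRing R] [DifferenceRing R] : Prop :=
  Nontrivial R ∧ ∀ I : Ideal R, (∀ x ∈ I, σ x ∈ I) → I = ⊥ ∨ I = ⊤

/-- The field `C_K` of constants of a difference field `K`. -/
def constants (K : Type*) [Field K] [DifferenceRing K] : Subfield K :=
  RingHom.eqLocusField ((σ : K ≃+* K) : K →+* K) (RingHom.id K)

theorem mem_constants {K : Type*} [Field K] [DifferenceRing K] {x : K} :
    x ∈ constants K ↔ σ x = x := Iff.rfl

/-- `C_R = C_K`: every constant of `R` comes from a constant of the difference field `K`. -/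
def NoNewConstants (K R : Type*) [Field K] [DifferenceRing K] [CommRing R] [DifferenceRing R]
    [Algebra K R] : Prop :=
  ∀ x : R, σ x = x → ∃ c ∈ constants K, algebraMap K R c = x

/-- For a difference field extension `K` of `k`, the inclusion `C_k → C_K`. -/
instance constantsAlgebra (k K : Type*) [Field k] [DifferenceRing k] [Field K] [DifferenceRing K]
    [Algebra k K] [Extension k K] : Algebra (constants k) (constants K) :=
  (((algebraMap k K).comp (constants k).subtype).codRestrict (constants K) fun c => by
    rw [mem_constants]
    change σ (algebraMap k K c) = algebraMap k K c
    rw [Extension.σ_algebraMap, mem_constants.1 c.2]).toAlgebra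

/-! ### Solutions of `σ Y = A Y` -/

/-- A fundamental matrix in `R` for the equation `σ Y = A Y` with `A ∈ GL_n(K)`:
a matrix `Z ∈ GL_n(R)` with `σ Z = A Z`. -/
structure FundamentalMatrix {K : Type*} [Field K] {n : ℕ} (A : GL (Fin n) K)
    (R : Type*) [CommRing R] [DifferenceRing R] [Algebra K R] where
  mat : GL (Fin n) R
  map_σ : Matrix.GeneralLinearGroup.map ((σ : R ≃+* R) : R →+* R) mat =
    Matrix.GeneralLinearGroup.map (algebraMap K R) A * mat

namespace FundamentalMatrix

variable {K : Type*} [Field K] {n : ℕ} {A : GL (Fin n) K}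
  {R : Type*} [CommRing R] [DifferenceRing R] [Algebra K R]

/-- The subring `K[Z, 1/det Z]` of `R`. -/
def ring (Z : FundamentalMatrix A R) : Subalgebra K R :=
  Algebra.adjoin K (Set.range (fun p : Fin n × Fin n => Z.mat p.1 p.2) ∪
    {((Matrix.GeneralLinearGroup.det Z.mat)⁻¹ : Rˣ).1})

theorem entry_mem (Z : FundamentalMatrix A R) (i j : Fin n) : Z.mat i j ∈ Z.ring :=
  Algebra.subset_adjoin (Or.inl ⟨(i, j), rfl⟩)

theorem det_inv_mem (Z : FundamentalMatrix A R) :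
    ((Matrix.GeneralLinearGroup.det Z.mat)⁻¹ : Rˣ).1 ∈ Z.ring :=
  Algebra.subset_adjoin (Or.inr rfl)

theorem algebraMap_mul_entry_mem (Z : FundamentalMatrix A R) (B : GL (Fin n) K) (i j : Fin n) :
    (Matrix.GeneralLinearGroup.map (algebraMap K R) B * Z.mat) i j ∈ Z.ring := by
  rw [Units.val_mul, Matrix.mul_apply]
  refine Subalgebra.sum_mem _ fun l _ => Subalgebra.mul_mem _ ?_ (Z.entry_mem l j)
  rw [Matrix.GeneralLinearGroup.map_apply]
  exact Subalgebra.algebraMap_mem _ _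

/-- If a ring automorphism `τ` of `R` preserves `K` and `τ Z = B Z` with `B ∈ GL_n(K)`,
then `τ` maps `K[Z, 1/det Z]` to itself. -/
theorem apply_mem_of_map_eq (Z : FundamentalMatrix A R) (τ : R ≃+* R)
    (hτ : ∀ a : K, ∃ b : K, τ (algebraMap K R a) = algebraMap K R b) (B : GL (Fin n) K)
    (hB : Matrix.GeneralLinearGroup.map (τ : R →+* R) Z.mat =
      Matrix.GeneralLinearGroup.map (algebraMap K R) B * Z.mat) {x : R} (hx : x ∈ Z.ring) :
    τ x ∈ Z.ring := by
  induction hx using Algebra.adjoin_induction with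
  | mem x hx =>
    rcases hx with ⟨p, rfl⟩ | rfl
    · have h := Z.algebraMap_mul_entry_mem B p.1 p.2
      rw [← hB, Matrix.GeneralLinearGroup.map_apply] at h
      exact h
    · have h : Units.map ((τ : R →+* R) : R →* R) (Matrix.GeneralLinearGroup.det Z.mat)⁻¹ =
          Units.map ((algebraMap K R : K →+* R) : K →* R)
            (Matrix.GeneralLinearGroup.det B)⁻¹ * (Matrix.GeneralLinearGroup.det Z.mat)⁻¹ := by
        rw [map_inv, ← Matrix.GeneralLinearGroup.map_det, hB, map_mul,
          Matrix.GeneralLinearGroup.map_det, mul_inv, map_inv]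
      have h' := congrArg Units.val h
      have h2 : τ (((Matrix.GeneralLinearGroup.det Z.mat)⁻¹ : Rˣ).1) =
          algebraMap K R ((Matrix.GeneralLinearGroup.det B)⁻¹ : Kˣ).1 *
            ((Matrix.GeneralLinearGroup.det Z.mat)⁻¹ : Rˣ).1 := h'
      rw [h2]
      exact Subalgebra.mul_mem _ (Subalgebra.algebraMap_mem _ _) Z.det_inv_mem
  | algebraMap a =>
    obtain ⟨b, hb⟩ := hτ a
    rw [hb]
    exact Subalgebra.algebraMap_mem _ _
  | add x y _ _ hx hy => rw [map_add]; exact Subalgebra.add_mem _ hx hy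
  | mul x y _ _ hx hy => rw [map_mul]; exact Subalgebra.mul_mem _ hx hy

variable [DifferenceRing K] [Extension K R]

theorem σ_mem (Z : FundamentalMatrix A R) {x : R} (hx : x ∈ Z.ring) : σ x ∈ Z.ring :=
  Z.apply_mem_of_map_eq σ (fun a => ⟨σ a, Extension.σ_algebraMap a⟩) A Z.map_σ hx

theorem σ_symm_algebraMap (a : K) :
    (σ : R ≃+* R).symm (algebraMap K R a) = algebraMap K R ((σ : K ≃+* K).symm a) := by
  rw [RingEquiv.symm_apply_eq, Extension.σ_algebraMap, RingEquiv.apply_symm_apply]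

theorem σ_symm_mem (Z : FundamentalMatrix A R) {x : R} (hx : x ∈ Z.ring) :
    (σ : R ≃+* R).symm x ∈ Z.ring := by
  refine Z.apply_mem_of_map_eq (σ : R ≃+* R).symm (fun a => ⟨_, σ_symm_algebraMap a⟩)
    (Matrix.GeneralLinearGroup.map (((σ : K ≃+* K).symm : K ≃+* K) : K →+* K) A⁻¹) ?_ hx
  have h := congrArg
    (Matrix.GeneralLinearGroup.map (((σ : R ≃+* R).symm : R ≃+* R) : R →+* R)) Z.map_σ
  rw [map_mul] at h
  have h1 : Matrix.GeneralLinearGroup.map (((σ : R ≃+* R).symm : R ≃+* R) : R →+* R)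
      (Matrix.GeneralLinearGroup.map ((σ : R ≃+* R) : R →+* R) Z.mat) = Z.mat := by
    ext i j
    simp
  have h2 : Matrix.GeneralLinearGroup.map (((σ : R ≃+* R).symm : R ≃+* R) : R →+* R)
      (Matrix.GeneralLinearGroup.map (algebraMap K R) A) =
      Matrix.GeneralLinearGroup.map (algebraMap K R)
        (Matrix.GeneralLinearGroup.map (((σ : K ≃+* K).symm : K ≃+* K) : K →+* K) A) := by
    ext i j
    simp [σ_symm_algebraMap]
  rw [h1, h2] at h
  rw [map_inv, map_inv]
  exact eq_inv_mul_of_mul_eq h.symm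

/-- `K[Z, 1/det Z]` is a difference ring with the restriction of the automorphism of `R`. -/
instance differenceRing (Z : FundamentalMatrix A R) : DifferenceRing Z.ring where
  σ :=
    { toFun := fun x => ⟨σ x.1, Z.σ_mem x.2⟩
      invFun := fun x => ⟨(σ : R ≃+* R).symm x.1, Z.σ_symm_mem x.2⟩
      left_inv := fun _ => Subtype.ext (RingEquiv.symm_apply_apply _ _)
      right_inv := fun _ => Subtype.ext (RingEquiv.apply_symm_apply _ _)
      map_mul' := fun _ _ => Subtype.ext (map_mul _ _ _)
      map_add' := fun _ _ => Subtype.ext (map_add _ _ _) }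

theorem coe_σ (Z : FundamentalMatrix A R) (x : Z.ring) :
    ((σ x : Z.ring) : R) = σ (x : R) := rfl

instance extension (Z : FundamentalMatrix A R) : Extension K Z.ring where
  σ_algebraMap a := Subtype.ext (Extension.σ_algebraMap (K := K) (R := R) a)

end FundamentalMatrix

section PicardVessiot

variable {K : Type*} [Field K] [DifferenceRing K] {n : ℕ} (A : GL (Fin n) K)

/-- A Picard-Vessiot ring for `σ Y = A Y` over the difference field `K`: a simple difference ring
extension of `K` of the form `K[Z, 1/det Z]` with `Z` a fundamental matrix. -/
def IsPicardVessiotRing (R : Type*) [CommRing R] [DifferenceRing R] [Algebra K R]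
    [Extension K R] : Prop :=
  (∃ Z : FundamentalMatrix A R, Z.ring = ⊤) ∧ IsSimple R

/-- A weak Picard-Vessiot ring for `σ Y = A Y` over the difference field `K`: a difference ring
extension of `K` of the form `K[Z, 1/det Z]` with `Z` a fundamental matrix, and without
new constants. It is nonzero, since it contains `K`. -/
def IsWeakPicardVessiotRing (R : Type*) [CommRing R] [DifferenceRing R] [Algebra K R]
    [Extension K R] : Prop :=
  Nontrivial R ∧ (∃ Z : FundamentalMatrix A R, Z.ring = ⊤) ∧ NoNewConstants K R

/-- A weak Picard-Vessiot field for `σ Y = A Y` over the difference field `K`: a difference field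
extension `L` of `K` without new constants which is the quotient field of a weak Picard-Vessiot
ring. A subring of `L` of the form `K[Z, 1/det Z]` is determined by the matrix `Z` in `GL_n(L)`. -/
def IsWeakPicardVessiotField (L : Type*) [Field L] [DifferenceRing L] [Algebra K L]
    [Extension K L] : Prop :=
  NoNewConstants K L ∧
    ∃ Z : FundamentalMatrix A L, IsWeakPicardVessiotRing A Z.ring ∧ IsFractionRing Z.ring L

end PicardVessiot

/-! ### Extension of the base field -/

section BaseChange

variable (k K R : Type*) [Field k] [DifferenceRing k] [Field K] [DifferenceRing K] [Algebra k K]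
  [Extension k K] [CommRing R] [DifferenceRing R] [Algebra k R] [Extension k R]

/-- The automorphism of a difference ring extension of `k`, as a map semilinear over the
automorphism of `k`. -/
def σSemilinear : R →ₛₗ[((σ : k ≃+* k) : k →+* k)] R where
  toFun := σ
  map_add' := map_add _
  map_smul' a x := by
    rw [Algebra.smul_def, map_mul, Extension.σ_algebraMap, Algebra.smul_def]
    rfl

theorem map_σ_mul (x y : K ⊗[k] R) :
    TensorProduct.map (σSemilinear k K) (σSemilinear k R) (x * y) =
      TensorProduct.map (σSemilinear k K) (σSemilinear k R) x *
        TensorProduct.map (σSemilinear k K) (σSemilinear k R) y := by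
  induction x with
  | zero => simp
  | add x₁ x₂ h₁ h₂ => rw [add_mul, map_add, h₁, h₂, map_add, add_mul]
  | tmul a r =>
    induction y with
    | zero => simp
    | add y₁ y₂ h₁ h₂ => rw [mul_add, map_add, h₁, h₂, map_add, mul_add]
    | tmul b s => simp [σSemilinear]

/-- The ring endomorphism `a ⊗ r ↦ σ a ⊗ σ r` of `K ⊗_k R`. -/
def σTensorHom : K ⊗[k] R →+* K ⊗[k] R where
  toFun := TensorProduct.map (σSemilinear k K) (σSemilinear k R)
  map_one' := by simp [Algebra.TensorProduct.one_def, σSemilinear]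
  map_mul' := map_σ_mul k K R
  map_zero' := map_zero _
  map_add' := map_add _

theorem σTensorHom_tmul (a : K) (r : R) :
    σTensorHom k K R (a ⊗ₜ r) = (σ a) ⊗ₜ (σ r) := rfl

theorem σTensorHom_bijective : Function.Bijective (σTensorHom k K R) := by
  let _ : RingHomInvPair ((σ : k ≃+* k) : k →+* k) (((σ : k ≃+* k).symm : k ≃+* k) : k →+* k) :=
    RingHomInvPair.of_ringEquiv σ
  let inv (M : Type _) [CommRing M] [DifferenceRing M] [Algebra k M] [Extension k M] :
      M →ₛₗ[(((σ : k ≃+* k).symm : k ≃+* k) : k →+* k)] M :=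
    { toFun := (σ : M ≃+* M).symm
      map_add' := map_add _
      map_smul' := fun a x => by
        rw [RingEquiv.symm_apply_eq, Algebra.smul_def, Algebra.smul_def, map_mul,
          Extension.σ_algebraMap, RingEquiv.apply_symm_apply]
        simp }
  let invK : K →ₛₗ[(((σ : k ≃+* k).symm : k ≃+* k) : k →+* k)] K :=
    { toFun := (σ : K ≃+* K).symm
      map_add' := map_add _
      map_smul' := fun a x => by
        rw [RingEquiv.symm_apply_eq, Algebra.smul_def, Algebra.smul_def, map_mul,
          Extension.σ_algebraMap, RingEquiv.apply_symm_apply]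
        simp }
  refine Function.bijective_iff_has_inverse.2 ⟨TensorProduct.map invK (inv R), ?_, ?_⟩
  · intro x
    induction x with
    | zero => simp
    | add x y hx hy => rw [map_add, map_add, hx, hy]
    | tmul a r => simp [σTensorHom_tmul, invK, inv]
  · intro x
    induction x with
    | zero => simp
    | add x y hx hy => rw [map_add, map_add, hx, hy]
    | tmul a r => simp [σTensorHom_tmul, invK, inv]

/-- The extension `K ⊗_k R` of the base field of `R` from `k` to `K`. -/
def BaseChange : Type _ := K ⊗[k] R

namespace BaseChange

noncomputable instance : CommRing (BaseChange k K R) := inferInstanceAs (CommRing (K ⊗[k] R))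

noncomputable instance : Algebra K (BaseChange k K R) := inferInstanceAs (Algebra K (K ⊗[k] R))

/-- `K ⊗_k R` is a difference ring with `σ (a ⊗ r) = σ a ⊗ σ r`. -/
noncomputable instance : DifferenceRing (BaseChange k K R) where
  σ := RingEquiv.ofBijective (σTensorHom k K R) (σTensorHom_bijective k K R)

variable {K R} in
/-- The element `a ⊗ r` of `K ⊗_k R`. -/
def mk (a : K) (r : R) : BaseChange k K R := a ⊗ₜ[k] r

theorem σ_mk (a : K) (r : R) : σ (mk k a r) = mk k (σ a) (σ r) := rfl

theorem algebraMap_eq (a : K) : algebraMap K (BaseChange k K R) a = mk k a 1 :=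
  Algebra.TensorProduct.algebraMap_apply a

instance : Extension K (BaseChange k K R) where
  σ_algebraMap a := by rw [algebraMap_eq, algebraMap_eq, σ_mk, map_one]

end BaseChange

end BaseChange

/-! ### Extension of the constants and the Galois group -/

section Galois

variable (K R : Type u) [Field K] [DifferenceRing K] [CommRing R] [DifferenceRing R] [Algebra K R]
  [Extension K R]

/-- The automorphism of `R`, as an automorphism over the constants of `K`. -/
def σConst : R ≃ₐ[constants K] R :=
  AlgEquiv.ofRingEquiv (f := (σ : R ≃+* R)) fun c => by
    change σ (algebraMap K R c) = algebraMap K R c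
    rw [Extension.σ_algebraMap, mem_constants.1 c.2]

/-- The automorphism `r ⊗ b ↦ σ r ⊗ b` of `R ⊗_C B`, where `C` is the field of constants of `K`
and `B` is a `C`-algebra. -/
noncomputable def σExt (B : Type u) [CommRing B] [Algebra (constants K) B] :
    (R ⊗[constants K] B) ≃+* (R ⊗[constants K] B) :=
  (Algebra.TensorProduct.congr (σConst K R) (AlgEquiv.refl : B ≃ₐ[constants K] B)).toRingEquiv

theorem σExt_tmul (B : Type u) [CommRing B] [Algebra (constants K) B] (r : R) (b : B) :
    σExt K R B (r ⊗ₜ b) = (σ r) ⊗ₜ b := rfl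

/-- The group of `B`-points of the Galois group of `R` over `K`: the automorphisms of `R ⊗_C B`
which are linear over `K ⊗_C B` (that is, over `K` and over `B`) and commute with `σ`. -/
def galoisPoints (B : Type u) [CommRing B] [Algebra (constants K) B] :
    Subgroup ((R ⊗[constants K] B) ≃ₐ[K] (R ⊗[constants K] B)) where
  carrier := {φ | (∀ b : B, φ (1 ⊗ₜ b) = 1 ⊗ₜ b) ∧ ∀ x, φ (σExt K R B x) = σExt K R B (φ x)}
  one_mem' := ⟨fun _ => rfl, fun _ => rfl⟩
  mul_mem' := fun {φ ψ} hφ hψ =>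
    ⟨fun b => by rw [AlgEquiv.mul_apply, hψ.1, hφ.1],
      fun x => by rw [AlgEquiv.mul_apply, hψ.2, hφ.2, AlgEquiv.mul_apply]⟩
  inv_mem' := fun {φ} hφ =>
    ⟨fun b => (AlgEquiv.symm_apply_eq φ).2 (hφ.1 b).symm,
      fun x => (AlgEquiv.symm_apply_eq φ).2 (by
        rw [hφ.2]
        exact congrArg _ (AlgEquiv.apply_symm_apply φ x).symm)⟩

section Functoriality

variable {K R} {B B' B'' : Type u} [CommRing B] [Algebra (constants K) B]
  [CommRing B'] [Algebra (constants K) B'] [CommRing B''] [Algebra (constants K) B'']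

variable (R) in
/-- The map `id ⊗ f : R ⊗_C B → R ⊗_C B'`. -/
noncomputable def tensorMap (f : B →ₐ[constants K] B') :
    (R ⊗[constants K] B) →ₐ[K] (R ⊗[constants K] B') :=
  Algebra.TensorProduct.map (AlgHom.id K R) f

/-- The `B'`-linear extension of `φ` along `f : B → B'`. -/
noncomputable def extendHom (f : B →ₐ[constants K] B')
    (φ : (R ⊗[constants K] B) ≃ₐ[K] (R ⊗[constants K] B)) :
    (R ⊗[constants K] B') →ₐ[K] (R ⊗[constants K] B') :=
  Algebra.TensorProduct.lift
    ((tensorMap R f).comp (φ.toAlgHom.comp Algebra.TensorProduct.includeLeft))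
    Algebra.TensorProduct.includeRight fun _ _ => Commute.all _ _

theorem extendHom_tmul (f : B →ₐ[constants K] B')
    (φ : (R ⊗[constants K] B) ≃ₐ[K] (R ⊗[constants K] B)) (r : R) (b : B') :
    extendHom f φ (r ⊗ₜ b) = tensorMap R f (φ (r ⊗ₜ 1)) * (1 ⊗ₜ b) := by
  simp [extendHom]

theorem tmul_eq (r : R) (b : B) : (r ⊗ₜ[constants K] b) = (r ⊗ₜ 1) * (1 ⊗ₜ b) := by simp

theorem extendHom_tensorMap (f : B →ₐ[constants K] B') (φ : galoisPoints K R B)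
    (x : R ⊗[constants K] B) :
    extendHom f φ.1 (tensorMap R f x) = tensorMap R f (φ.1 x) := by
  induction x with
  | zero => simp
  | add x y hx hy => rw [map_add, map_add, hx, hy, map_add, map_add]
  | tmul r b =>
    have h : φ.1 (r ⊗ₜ b) = φ.1 (r ⊗ₜ 1) * (1 ⊗ₜ b) := by
      rw [tmul_eq, map_mul, φ.2.1]
    have h' : tensorMap R f (r ⊗ₜ b) = r ⊗ₜ f b := by simp [tensorMap]
    have h'' : tensorMap R f ((1 : R) ⊗ₜ b) = 1 ⊗ₜ f b := by simp [tensorMap]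
    rw [h, h', extendHom_tmul, map_mul, h'']

theorem extendHom_mul (f : B →ₐ[constants K] B') (φ ψ : galoisPoints K R B)
    (x : R ⊗[constants K] B') :
    extendHom f (φ * ψ).1 x = extendHom f φ.1 (extendHom f ψ.1 x) := by
  induction x with
  | zero => simp
  | add x y hx hy => rw [map_add, map_add, hx, hy, map_add]
  | tmul r b =>
    have h : extendHom f φ.1 ((1 : R) ⊗ₜ b) = 1 ⊗ₜ b := by
      rw [extendHom_tmul, ← Algebra.TensorProduct.one_def, map_one, map_one, one_mul]
    rw [extendHom_tmul, extendHom_tmul, map_mul, extendHom_tensorMap, h]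
    rfl

theorem extendHom_one (f : B →ₐ[constants K] B') (x : R ⊗[constants K] B') :
    extendHom f (1 : galoisPoints K R B).1 x = x := by
  induction x with
  | zero => simp
  | add x y hx hy => rw [map_add, hx, hy]
  | tmul r b =>
    rw [extendHom_tmul, tmul_eq]
    simp [tensorMap]

theorem tensorMap_σExt (f : B →ₐ[constants K] B') (x : R ⊗[constants K] B) :
    tensorMap R f (σExt K R B x) = σExt K R B' (tensorMap R f x) := by
  induction x with
  | zero => simp
  | add x y hx hy => rw [map_add, map_add, hx, hy, map_add, map_add]
  | tmul r b => simp [tensorMap, σExt_tmul]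

theorem extendHom_σExt (f : B →ₐ[constants K] B') (φ : galoisPoints K R B)
    (x : R ⊗[constants K] B') :
    extendHom f φ.1 (σExt K R B' x) = σExt K R B' (extendHom f φ.1 x) := by
  induction x with
  | zero => simp
  | add x y hx hy => rw [map_add, map_add, hx, hy, map_add, map_add]
  | tmul r b =>
    have h : φ.1 (σ r ⊗ₜ 1) = σExt K R B (φ.1 (r ⊗ₜ 1)) := by
      rw [← φ.2.2, σExt_tmul]
    rw [σExt_tmul, extendHom_tmul, extendHom_tmul, map_mul, h, tensorMap_σExt, σExt_tmul, map_one]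

/-- The group homomorphism from `B`-points to `B'`-points given by `B'`-linear extension. -/
noncomputable def galoisMap (f : B →ₐ[constants K] B') :
    galoisPoints K R B →* galoisPoints K R B' where
  toFun φ :=
    ⟨AlgEquiv.ofAlgHom (extendHom f φ.1) (extendHom f (φ⁻¹).1)
      (AlgHom.ext fun x => by
        change extendHom f φ.1 (extendHom f (φ⁻¹).1 x) = x
        rw [← extendHom_mul, mul_inv_cancel, extendHom_one])
      (AlgHom.ext fun x => by
        change extendHom f (φ⁻¹).1 (extendHom f φ.1 x) = x
        rw [← extendHom_mul, inv_mul_cancel, extendHom_one]),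
     ⟨fun b => by
        change extendHom f φ.1 ((1 : R) ⊗ₜ b) = 1 ⊗ₜ b
        rw [extendHom_tmul, ← Algebra.TensorProduct.one_def, map_one, map_one, one_mul],
      extendHom_σExt f φ⟩⟩
  map_one' := Subtype.ext (AlgEquiv.ext (extendHom_one f))
  map_mul' φ ψ := Subtype.ext (AlgEquiv.ext (extendHom_mul f φ ψ))

theorem galoisMap_id (φ : galoisPoints K R B) :
    galoisMap (AlgHom.id (constants K) B) φ = φ := by
  refine Subtype.ext (AlgEquiv.ext fun x => ?_)
  change extendHom _ φ.1 x = φ.1 x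
  have h := extendHom_tensorMap (AlgHom.id (constants K) B) φ x
  simpa [tensorMap] using h

theorem galoisMap_comp (g : B' →ₐ[constants K] B'') (f : B →ₐ[constants K] B')
    (φ : galoisPoints K R B) :
    galoisMap (g.comp f) φ = galoisMap g (galoisMap f φ) := by
  refine Subtype.ext (AlgEquiv.ext fun x => ?_)
  change extendHom (g.comp f) φ.1 x = extendHom g (galoisMap f φ).1 x
  have hc : ∀ y : R ⊗[constants K] B,
      tensorMap R (g.comp f) y = tensorMap R g (tensorMap R f y) := fun y => by
    induction y with
    | zero => simp
    | add x y hx hy => rw [map_add, map_add, map_add, hx, hy]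
    | tmul r b => simp [tensorMap]
  induction x with
  | zero => simp
  | add x y hx hy => rw [map_add, map_add, hx, hy]
  | tmul r b =>
    rw [extendHom_tmul, extendHom_tmul, hc]
    congr 2
    change _ = extendHom f φ.1 (r ⊗ₜ 1)
    rw [extendHom_tmul, ← Algebra.TensorProduct.one_def, mul_one]

end Functoriality

/-- The Galois group of `R` over `K`, as a functor from commutative algebras over the field `C` of
constants of `K` to groups: `B ↦ Aut^σ(R ⊗_C B / K ⊗_C B)`. -/
noncomputable def galoisGroup : CommAlgCat.{u} (constants K) ⥤ GrpCat.{u} where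
  obj B := GrpCat.of (galoisPoints K R B)
  map f := GrpCat.ofHom (galoisMap f.hom)
  map_id _ := GrpCat.hom_ext (MonoidHom.ext galoisMap_id)
  map_comp f g := GrpCat.hom_ext (MonoidHom.ext (galoisMap_comp g.hom f.hom))

end Galois

/-- A group functor over `C` is a linear algebraic group (an affine group scheme of finite type)
if it is represented by a finitely generated `C`-algebra. -/
def IsLinearAlgebraicGroup {C : Type u} [Field C] (G : CommAlgCat.{u} C ⥤ GrpCat.{u}) : Prop :=
  ∃ U : CommAlgCat.{u} C, Algebra.FiniteType C U ∧
    Nonempty ((G ⋙ forget GrpCat.{u}).CorepresentableBy U)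

/-- Restriction of scalars of commutative algebras from `F` to `C`. -/
def restrictAlg (C F : Type u) [Field C] [Field F] [Algebra C F] :
    CommAlgCat.{u} F ⥤ CommAlgCat.{u} C where
  obj B :=
    letI : Algebra C B := Algebra.compHom B (algebraMap C F)
    CommAlgCat.of C B
  map {B B'} f :=
    letI : Algebra C B := Algebra.compHom B (algebraMap C F)
    letI : Algebra C B' := Algebra.compHom B' (algebraMap C F)
    CommAlgCat.ofHom
      ({ f.hom.toRingHom with commutes' := fun c => f.hom.commutes (algebraMap C F c) } :
        B →ₐ[C] B')

/-- The base change to `F` of a group functor over `C`: its `B`-points, for an `F`-algebra `B`,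
are the points of the given functor in `B` viewed as a `C`-algebra. -/
def groupBaseChange {C : Type u} [Field C] (F : Type u) [Field F] [Algebra C F]
    (G : CommAlgCat.{u} C ⥤ GrpCat.{u}) : CommAlgCat.{u} F ⥤ GrpCat.{u} :=
  restrictAlg C F ⋙ G

end DifferenceRing

open DifferenceRing

/-! Two principles drive the proof. If `R` is simple over `K` without new constants, then every
nonzero invariant ideal of `R ⊗ B` (with `B` an algebra over the constants) contains a nonzero
element of `B`. Hence an equivariant homomorphism out of `R ⊗ B` is injective once it is injective
on `B` (`injective_of_equivariant`). Moreover two fundamental matrices in the same ring differ by a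
right factor whose entries are invariant, and the invariants of `M ⊗ B` are just `B` when `M` has no
new constants.

Since the constants of `k` are algebraically closed, `R` has no new constants
(`noNewConstants_of_isSimple`). Put `S = K ⊗ R`, with fundamental matrix `Z`. In `T ⊗_K S` the
matrix `U = V⁻¹ Z` is invariant, and it generates over `C_K` a finitely generated algebra `D` with
`T ⊗_{C_K} D ≃ T ⊗_K S` (`exists_mulHom_bijective`). Injectivity is checked inside the field `L`,
because simplicity of `T` is not yet known. The algebra `D` represents equivariant homomorphisms `S
→ T ⊗ B` (`exists_universal_hom`). It is nonzero, so the Nullstellensatz gives it a point in the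
algebraic closure `F`, that is, a homomorphism `S → T ⊗ F`.

The `F`-linear extension `Φ` of that homomorphism is surjective because it carries `Z` to `V` times
a matrix in `GL_n(F)`. It is injective because `K = k(C_K)`: up to a nonzero factor in `K`, every
element of `S ⊗ F` comes from `R ⊗_C F`, to which the first principle applies
(`injective_of_equivariant_baseChange`). Applying the same injectivity to quotients of `T` shows
that `T` is simple.

For the Galois groups, `D` with `S = M` is the representing algebra, since an equivariant
homomorphism `M → M ⊗ B` extends to an automorphism of `M ⊗ B`. Over an `F`-algebra `B`, `Φ` yields
an embedding of `R ⊗_C B` in `T ⊗_{C_K} B` whose image generates over `K`. Automorphisms of the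
small ring extend uniquely, those of the large ring restrict, and uniqueness makes the
correspondence multiplicative and natural in `B`. -/

set_option linter.unusedSectionVars false

namespace DifferenceRing

/-! ### Invariant elements and invariant ideals of `R ⊗ B` -/

section Invariant

variable {K R : Type u} [Field K] [DifferenceRing K] [CommRing R] [DifferenceRing R] [Algebra K R]
  [Extension K R] {B : Type u} [CommRing B] [Algebra (constants K) B]

/-- Because `σ` fixes the scalars in `constants K`, it fixes the `R`-basis of `R ⊗ B` induced from
`B` and acts on coordinates only. -/
theorem basis_repr_σExt {ι : Type*} (b : Module.Basis ι (constants K) B)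
    (x : R ⊗[constants K] B) (i : ι) :
    (Algebra.TensorProduct.basis R b).repr (σExt K R B x) i =
      σ ((Algebra.TensorProduct.basis R b).repr x i) := by
  induction x with
  | zero => simp
  | add x y hx hy => simp only [map_add, Finsupp.add_apply, hx, hy]
  | tmul r c =>
    rw [σExt_tmul, Algebra.TensorProduct.basis_repr_tmul, Algebra.TensorProduct.basis_repr_tmul]
    simp only [Finsupp.smul_apply, Finsupp.mapRange_apply, smul_eq_mul, map_mul]
    congr 1
    exact ((σConst K R).commutes _).symm

/-- The constants of `R ⊗_C B` are the elements of `B`. -/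
theorem exists_tmul_of_σExt_eq (hc : NoNewConstants K R) (x : R ⊗[constants K] B)
    (hx : σExt K R B x = x) : ∃ b : B, x = 1 ⊗ₜ b := by
  classical
  let b := Module.Free.chooseBasis (constants K) B
  have h : ∀ i, ∃ c : constants K,
      (Algebra.TensorProduct.basis R b).repr x i = algebraMap (constants K) R c := by
    intro i
    obtain ⟨c, hc, h⟩ := hc ((Algebra.TensorProduct.basis R b).repr x i)
      (by rw [← basis_repr_σExt, hx])
    exact ⟨⟨c, hc⟩, h.symm⟩
  choose c hc using h
  rw [← (Algebra.TensorProduct.basis R b).linearCombination_repr x, Finsupp.linearCombination_apply,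
    Finsupp.sum]
  refine ⟨∑ i ∈ ((Algebra.TensorProduct.basis R b).repr x).support, c i • b i, ?_⟩
  rw [TensorProduct.tmul_sum]
  refine Finset.sum_congr rfl fun i _ => ?_
  rw [hc, Algebra.TensorProduct.basis_apply, TensorProduct.smul_tmul', ← TensorProduct.smul_tmul,
    smul_eq_mul, mul_one, Algebra.algebraMap_eq_smul_one]

/-- Over a simple difference ring without new constants, every nonzero invariant ideal of
`R ⊗_C B` meets `B` nontrivially. -/
theorem exists_tmul_mem (hs : IsSimple R) (hc : NoNewConstants K R)
    (J : Ideal (R ⊗[constants K] B)) (hJ : ∀ x ∈ J, σExt K R B x ∈ J) (hne : J ≠ ⊥) :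
    ∃ b : B, b ≠ 0 ∧ (1 : R) ⊗ₜ b ∈ J := by
  classical
  let b := Module.Free.chooseBasis (constants K) B
  let e := Algebra.TensorProduct.basis R b
  obtain ⟨x₀, hx₀, hx₀'⟩ := Submodule.exists_mem_ne_zero_of_ne_bot hne
  -- Shortest-vector argument: `x` is a nonzero element of `J` with as few nonzero coordinates as
  -- possible.
  let P : ℕ → Prop := fun m => ∃ x ∈ J, x ≠ 0 ∧ (e.repr x).support.card = m
  have hP : ∃ m, P m := ⟨_, x₀, hx₀, hx₀', rfl⟩
  obtain ⟨x, hx, hx0, hcard⟩ := Nat.find_spec hP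
  have hmin : ∀ y ∈ J, (e.repr y).support ⊂ (e.repr x).support → y = 0 := by
    intro y hy hlt
    by_contra hy0
    exact Nat.find_min hP (hcard ▸ Finset.card_lt_card hlt) ⟨y, hy, hy0, rfl⟩
  have hsupp : (e.repr x).support.Nonempty := by
    rw [Finset.nonempty_iff_ne_empty]
    intro h
    exact hx0 (e.repr.map_eq_zero_iff.1 (Finsupp.support_eq_empty.1 h))
  obtain ⟨i, hi⟩ := hsupp
  have hmul : ∀ (r : R) (y : R ⊗[constants K] B), y ∈ J → r • y ∈ J := by
    intro r y hy
    have h : r • y = (r ⊗ₜ[constants K] (1 : B)) * y := by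
      clear hy
      induction y with
      | zero => simp
      | add y z hy hz => rw [smul_add, mul_add, hy, hz]
      | tmul s c => simp [TensorProduct.smul_tmul']
    rw [h]
    exact J.mul_mem_left _ hy
  -- The `i`-th coordinates of elements of `J` supported where `x` is form an invariant ideal;
  -- simplicity makes it all of `R`, so `x` can be replaced by an element `y` with `i`-th coordinate
  -- `1`.
  let I : Ideal R :=
    { carrier := {r | ∃ y ∈ J, (e.repr y).support ⊆ (e.repr x).support ∧ e.repr y i = r}
      zero_mem' := ⟨0, J.zero_mem, by simp, by simp⟩
      add_mem' := by
        rintro _ _ ⟨y, hy, hys, rfl⟩ ⟨z, hz, hzs, rfl⟩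
        refine ⟨y + z, J.add_mem hy hz, ?_, by simp⟩
        rw [map_add]
        exact Finsupp.support_add.trans (Finset.union_subset hys hzs)
      smul_mem' := by
        rintro r _ ⟨y, hy, hys, rfl⟩
        refine ⟨r • y, hmul r y hy, ?_, by simp⟩
        rw [map_smul]
        exact Finsupp.support_smul.trans hys }
  have hIσ : ∀ r ∈ I, σ r ∈ I := by
    rintro _ ⟨y, hy, hys, rfl⟩
    refine ⟨_, hJ y hy, fun j hj => hys ?_, basis_repr_σExt b y i⟩
    rw [Finsupp.mem_support_iff] at hj ⊢
    intro h
    exact hj (by rw [basis_repr_σExt, h, map_zero])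
  have hItop : I = ⊤ := by
    refine (hs.2 I hIσ).resolve_left fun h => Finsupp.mem_support_iff.1 hi ?_
    have : e.repr x i ∈ I := ⟨x, hx, subset_rfl, rfl⟩
    rwa [h] at this
  obtain ⟨y, hy, hys, hyi⟩ : (1 : R) ∈ I := hItop ▸ Submodule.mem_top
  -- The coordinate `1` is fixed by `σ`, so the difference loses the index `i` and vanishes by
  -- minimality.
  have hfix : σExt K R B y - y = 0 := by
    refine hmin _ (J.sub_mem (hJ y hy) hy) ⟨fun j hj => hys ?_, fun h => ?_⟩
    · rw [Finsupp.mem_support_iff] at hj ⊢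
      intro h
      refine hj ?_
      rw [map_sub, Finsupp.sub_apply, basis_repr_σExt, h, map_zero, sub_zero]
    · refine Finsupp.mem_support_iff.1 (h hi) ?_
      rw [map_sub, Finsupp.sub_apply, basis_repr_σExt, hyi, map_one, sub_self]
  obtain ⟨c, rfl⟩ := exists_tmul_of_σExt_eq hc y (sub_eq_zero.1 hfix)
  refine ⟨c, ?_, hy⟩
  rintro rfl
  have := hs.1
  rw [TensorProduct.tmul_zero, map_zero, Finsupp.zero_apply] at hyi
  exact zero_ne_one hyi

/-- An equivariant homomorphism out of `R ⊗_C B` with `R` simple and without new constants is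
injective as soon as it is injective on `B`. -/
theorem injective_of_equivariant (hs : IsSimple R) (hc : NoNewConstants K R) {N : Type*}
    [CommRing N] (τ : N →+* N) (μ : (R ⊗[constants K] B) →+* N)
    (hμ : ∀ x, μ (σExt K R B x) = τ (μ x)) (hB : ∀ b : B, μ (1 ⊗ₜ b) = 0 → b = 0) :
    Function.Injective μ := by
  rw [RingHom.injective_iff_ker_eq_bot]
  by_contra hne
  obtain ⟨b, hb, hb'⟩ := exists_tmul_mem hs hc (RingHom.ker μ)
    (fun x hx => by rw [RingHom.mem_ker] at hx ⊢; rw [hμ, hx, map_zero]) hne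
  exact hb (hB b hb')

theorem isSimple_of_field (L : Type*) [Field L] [DifferenceRing L] : IsSimple L :=
  ⟨inferInstance, fun I _ => Ideal.eq_bot_or_top I⟩

theorem includeRight_injective {M : Type u} [CommRing M] [Algebra K M] [Nontrivial M] :
    Function.Injective (Algebra.TensorProduct.includeRight : B →ₐ[constants K] M ⊗[constants K] B) :=
  Algebra.TensorProduct.includeRight_injective (algebraMap (constants K) M).injective

theorem eq_zero_of_one_tmul_eq_zero {M : Type u} [CommRing M] [Algebra K M] [Nontrivial M] {b : B}
    (h : (1 : M) ⊗ₜ[constants K] b = 0) : b = 0 :=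
  includeRight_injective (M := M) (by
    rw [map_zero]
    exact h)

end Invariant

/-! ### Matrices over subrings and generation by a fundamental matrix -/

section Generation

variable {N : Type*} [CommRing N] {n : ℕ}

/-- The matrices in `GL_n(N)` whose entries and inverse determinant lie in the subring `X`. -/
abbrev glSubgroup (n : ℕ) (X : Subring N) : Subgroup (GL (Fin n) N) :=
  (Matrix.GeneralLinearGroup.map (n := Fin n) X.subtype).range

theorem entry_mem_of_mem_glSubgroup {X : Subring N} {W : GL (Fin n) N}
    (hW : W ∈ glSubgroup n X) (i j : Fin n) : W i j ∈ X := by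
  obtain ⟨W, rfl⟩ := hW
  rw [Matrix.GeneralLinearGroup.map_apply]
  exact (W i j).2

theorem det_inv_mem_of_mem_glSubgroup {X : Subring N} {W : GL (Fin n) N}
    (hW : W ∈ glSubgroup n X) : ((Matrix.GeneralLinearGroup.det W)⁻¹ : Nˣ).1 ∈ X := by
  obtain ⟨W, rfl⟩ := hW
  rw [Matrix.GeneralLinearGroup.map_det, ← map_inv]
  exact (((Matrix.GeneralLinearGroup.det W)⁻¹ : Xˣ).1).2

/-- A matrix over `X` is invertible over `X` as soon as its determinant is a unit there. Membership
in a subgroup then gives closure under products and inverses without computing entries. -/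
theorem mem_glSubgroup {X : Subring N} {W : GL (Fin n) N} (h : ∀ i j, W i j ∈ X)
    (h' : ((Matrix.GeneralLinearGroup.det W)⁻¹ : Nˣ).1 ∈ X) : W ∈ glSubgroup n X := by
  let W₀ : Matrix (Fin n) (Fin n) X := Matrix.of fun i j => ⟨W i j, h i j⟩
  have hW₀ : X.subtype.mapMatrix W₀ = W.1 := by
    ext i j
    rfl
  have hdet : ((W₀.det : X) : N) = W.1.det := by
    have := X.subtype.map_det W₀
    rw [hW₀] at this
    exact this
  have hu : IsUnit W₀.det := by
    refine IsUnit.of_mul_eq_one ⟨_, h'⟩ (Subtype.ext ?_)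
    change ((W₀.det : X) : N) * _ = 1
    rw [hdet]
    exact (Matrix.GeneralLinearGroup.det W).mul_inv
  refine ⟨Matrix.GeneralLinearGroup.mk'' W₀ hu, ?_⟩
  ext i j
  rfl

theorem map_mem_glSubgroup {S : Type*} [CommRing S] {X : Subring N} (φ : S →+* N)
    (hφ : ∀ s, φ s ∈ X) (W : GL (Fin n) S) :
    Matrix.GeneralLinearGroup.map φ W ∈ glSubgroup n X := by
  refine mem_glSubgroup (fun i j => ?_) ?_
  · rw [Matrix.GeneralLinearGroup.map_apply]
    exact hφ _
  · rw [Matrix.GeneralLinearGroup.map_det, ← map_inv]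
    exact hφ _

/-- A homomorphism out of `K[Z, 1/det Z]` has values in every subring containing the image of
`K` and of `Z`. -/
theorem FundamentalMatrix.apply_mem {K S : Type*} [Field K] {A : GL (Fin n) K} [CommRing S]
    [DifferenceRing S] [Algebra K S] (Z : FundamentalMatrix A S) (hZ : Z.ring = ⊤) (φ : S →+* N)
    {X : Subring N} (hK : ∀ a, φ (algebraMap K S a) ∈ X)
    (h : Matrix.GeneralLinearGroup.map φ Z.mat ∈ glSubgroup n X) (s : S) : φ s ∈ X := by
  have hs : s ∈ Z.ring := hZ ▸ Algebra.mem_top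
  induction hs using Algebra.adjoin_induction with
  | mem x hx =>
    rcases hx with ⟨p, rfl⟩ | rfl
    · have := entry_mem_of_mem_glSubgroup h p.1 p.2
      rwa [Matrix.GeneralLinearGroup.map_apply] at this
    · have := det_inv_mem_of_mem_glSubgroup h
      rw [Matrix.GeneralLinearGroup.map_det, ← map_inv] at this
      exact this
  | algebraMap a => exact hK a
  | add x y _ _ hx hy => rw [map_add]; exact X.add_mem hx hy
  | mul x y _ _ hx hy => rw [map_mul]; exact X.mul_mem hx hy

end Generation

/-! ### Simple rings over algebraically closed constants have no new constants -/

section Constants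

variable {K R : Type*} [Field K] [DifferenceRing K] [CommRing R] [DifferenceRing R] [Algebra K R]
  [Extension K R]

/-- The principal ideal generated by a constant is invariant. -/
theorem IsSimple.isUnit_of_σ_eq {R : Type*} [CommRing R] [DifferenceRing R] (hs : IsSimple R)
    {x : R} (hx : σ x = x) (h0 : x ≠ 0) : IsUnit x := by
  refine Ideal.span_singleton_eq_top.1 ((hs.2 (Ideal.span {x}) fun y hy => ?_).resolve_left
    fun h => h0 (Ideal.span_singleton_eq_bot.1 h))
  obtain ⟨a, rfl⟩ := Ideal.mem_span_singleton'.1 hy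
  rw [map_mul, hx]
  exact Ideal.mul_mem_left _ _ (Ideal.mem_span_singleton_self x)

theorem σ_aeval {c : R} (hc : σ c = c) (p : Polynomial K) :
    σ (Polynomial.aeval c p) = Polynomial.aeval c (p.map ((σ : K ≃+* K) : K →+* K)) := by
  induction p using Polynomial.induction_on' with
  | add p q hp hq => simp only [map_add, Polynomial.map_add, hp, hq]
  | monomial m a =>
    simp [Polynomial.aeval_monomial, hc, Extension.σ_algebraMap]

/-- An algebraic constant has a minimal polynomial with constant coefficients, which splits over the
algebraically closed constants. Each factor `c - d` is a nonzero constant, hence a unit, yet their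
product with the leading coefficient is zero. -/
theorem transcendental_of_constant [IsAlgClosed (constants K)] (hs : IsSimple R) {c : R}
    (hc : σ c = c) (hne : ∀ d ∈ constants K, algebraMap K R d ≠ c) : Transcendental K c := by
  intro halg
  have := hs.1
  have hint : IsIntegral K c := halg.isIntegral
  -- Applying `σ` to the coefficients gives another monic polynomial of the same degree that kills
  -- `c`.
  have hmap : (minpoly K c).map ((σ : K ≃+* K) : K →+* K) = minpoly K c := by
    refine minpoly.unique K c ((minpoly.monic hint).map _) ?_ fun q hq hq0 => ?_
    · rw [← σ_aeval hc, minpoly.aeval, map_zero]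
    · rw [Polynomial.degree_map]
      exact minpoly.min K c hq hq0
  have hcoeff : ∀ i, (minpoly K c).coeff i ∈ constants K := by
    intro i
    rw [mem_constants]
    conv_rhs => rw [← hmap]
    rw [Polynomial.coeff_map]
    rfl
  obtain ⟨q, hq⟩ : minpoly K c ∈ Polynomial.lifts (algebraMap (constants K) K) :=
    (Polynomial.lifts_iff_coeff_lifts _).2 fun i => ⟨⟨_, hcoeff i⟩, rfl⟩
  have hq' : q.map (algebraMap (constants K) K) = minpoly K c := hq
  have hq0 : q ≠ 0 := by
    rintro rfl
    exact minpoly.ne_zero hint (by rw [← hq', Polynomial.map_zero])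
  have hprod := (IsAlgClosed.splits q).eq_prod_roots
  have h0 : Polynomial.aeval c q = 0 := by
    rw [← Polynomial.aeval_map_algebraMap K, hq', minpoly.aeval]
  have hu : IsUnit (Polynomial.aeval c q) := by
    rw [hprod, map_mul, Polynomial.aeval_C, map_multiset_prod, Multiset.map_map]
    refine IsUnit.mul ?_ ?_
    · exact (IsUnit.mk0 _ (Polynomial.leadingCoeff_ne_zero.2 hq0)).map _
    · refine Multiset.prod_induction IsUnit _ (fun _ _ => IsUnit.mul) isUnit_one fun x hx => ?_
      obtain ⟨d, -, rfl⟩ := Multiset.mem_map.1 hx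
      have h1 : algebraMap (constants K) R d = algebraMap K R d := rfl
      simp only [Function.comp_apply, map_sub, Polynomial.aeval_X, Polynomial.aeval_C, h1]
      refine hs.isUnit_of_σ_eq ?_ (sub_ne_zero.2 (hne d d.2).symm)
      rw [map_sub, hc, Extension.σ_algebraMap, mem_constants.1 d.2]
  rw [h0] at hu
  exact not_isUnit_zero hu

/-- A simple finitely generated difference ring over a difference field with algebraically closed
constants has no new constants. -/
theorem noNewConstants_of_isSimple [IsAlgClosed (constants K)] [Algebra.FiniteType K R]
    (hs : IsSimple R) : NoNewConstants K R := by
  intro c hc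
  classical
  by_contra! hne
  have := hs.1
  have htr := transcendental_of_constant hs hc hne
  let _ : Algebra (Polynomial K) R := (Polynomial.aeval (R := K) c).toAlgebra
  have hmap (p : Polynomial K) : algebraMap (Polynomial K) R p = Polynomial.aeval c p := rfl
  have : IsScalarTower K (Polynomial K) R := IsScalarTower.of_algebraMap_eq fun a => by
    rw [hmap, ← Polynomial.C_eq_algebraMap, Polynomial.aeval_C]
  have : Algebra.FiniteType (Polynomial K) R :=
    Algebra.FiniteType.of_restrictScalars_finiteType K _ _
  have : Algebra.FinitePresentation (Polynomial K) R :=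
    Algebra.FinitePresentation.of_finiteType.1 this
  -- The torsion of `R` over `K[c]`. It is invariant because `σ c = c`, and proper because `c` is
  -- transcendental, so it vanishes.
  let I : Ideal R :=
    { carrier := {r | ∃ p : Polynomial K, p ≠ 0 ∧ Polynomial.aeval c p * r = 0}
      zero_mem' := ⟨1, one_ne_zero, mul_zero _⟩
      add_mem' := by
        rintro r s ⟨p, hp, hr⟩ ⟨q, hq, hs⟩
        refine ⟨p * q, mul_ne_zero hp hq, ?_⟩
        rw [map_mul]
        linear_combination Polynomial.aeval c q * hr + Polynomial.aeval c p * hs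
      smul_mem' := by
        rintro s r ⟨p, hp, hr⟩
        refine ⟨p, hp, ?_⟩
        rw [smul_eq_mul]
        linear_combination s * hr }
  have hI : I = ⊥ := by
    refine (hs.2 I ?_).resolve_right fun h => ?_
    · rintro r ⟨p, hp, hr⟩
      refine ⟨p.map ((σ : K ≃+* K) : K →+* K),
        (Polynomial.map_ne_zero_iff (σ : K ≃+* K).injective).2 hp, ?_⟩
      rw [← σ_aeval hc, ← map_mul, hr, map_zero]
    · obtain ⟨p, hp, h1⟩ : (1 : R) ∈ I := h ▸ Submodule.mem_top
      rw [mul_one] at h1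
      exact hp ((transcendental_iff.1 htr) p h1)
  have : Module.IsTorsionFree (Polynomial K) R := by
    refine ⟨fun p hp r s hrs => ?_⟩
    have : r - s ∈ I := by
      refine ⟨p, hp.ne_zero, ?_⟩
      rw [mul_sub, sub_eq_zero, ← hmap, ← Algebra.smul_def, ← Algebra.smul_def]
      exact hrs
    rw [hI] at this
    exact sub_eq_zero.1 this
  -- Torsion-free over the principal ideal domain `K[X]` means flat, so going down holds, and finite
  -- presentation makes the map on spectra open. Its image thus contains a nonempty basic open set,
  -- the locus where some `g ≠ 0` does not vanish.
  have hopen := PrimeSpectrum.isOpenMap_comap_of_hasGoingDown_of_finitePresentation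
    (R := Polynomial K) (S := R)
  obtain ⟨q⟩ := (inferInstance : Nonempty (PrimeSpectrum R))
  obtain ⟨_, ⟨_, ⟨g, rfl⟩, rfl⟩, hg, hgU⟩ := PrimeSpectrum.isBasis_basic_opens.exists_subset_of_mem_open
    (Set.mem_range_self q) hopen.isOpen_range
  have hg0 : g ≠ 0 := by
    rintro rfl
    exact hg (Submodule.zero_mem _)
  have hinf : (Set.range fun d : constants K => (d : K)).Infinite :=
    have := IsAlgClosed.instInfinite (K := constants K)
    Set.infinite_range_of_injective Subtype.val_injective
  -- A constant `d` off the roots of `g` gives a point in the image, so `c - d` lies in a prime of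
  -- `R`, although it is a nonzero constant and hence a unit.
  obtain ⟨_, ⟨d, rfl⟩, hd⟩ := hinf.exists_notMem_finset g.roots.toFinset
  have hroot : ¬ g.IsRoot (d : K) := by
    simpa [Polynomial.mem_roots hg0] using hd
  let P : PrimeSpectrum (Polynomial K) := ⟨Ideal.span {Polynomial.X - Polynomial.C (d : K)},
    (Ideal.span_singleton_prime (Polynomial.X_sub_C_ne_zero _)).2 (Polynomial.prime_X_sub_C _)⟩
  obtain ⟨Q, hQ⟩ := hgU (show P ∈ PrimeSpectrum.basicOpen g from fun h =>
    hroot (Polynomial.dvd_iff_isRoot.1 (Ideal.mem_span_singleton.1 h)))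
  have hmem : Polynomial.X - Polynomial.C (d : K) ∈
      (PrimeSpectrum.comap (algebraMap (Polynomial K) R) Q).asIdeal := by
    rw [hQ]
    exact Ideal.mem_span_singleton_self _
  rw [PrimeSpectrum.comap_asIdeal, Ideal.mem_comap, hmap, map_sub, Polynomial.aeval_X,
    Polynomial.aeval_C] at hmem
  refine Q.2.ne_top (Ideal.eq_top_of_isUnit_mem _ hmem (hs.isUnit_of_σ_eq ?_
    (sub_ne_zero.2 (hne d d.2).symm)))
  rw [map_sub, hc, Extension.σ_algebraMap, mem_constants.1 d.2]

theorem FundamentalMatrix.finiteType {n : ℕ} {A : GL (Fin n) K} (Z : FundamentalMatrix A R)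
    (hZ : Z.ring = ⊤) : Algebra.FiniteType K R :=
  ⟨Subalgebra.fg_def.2 ⟨_, (Set.finite_range _).union (Set.finite_singleton _), hZ⟩⟩

end Constants

/-! ### Comparing solutions of the same matrix equation -/

section Matrix

variable {K S N N' : Type*} [Field K] [DifferenceRing K] {n : ℕ} {A : GL (Fin n) K} [CommRing S]
  [DifferenceRing S] [Algebra K S] [CommRing N] [Algebra K N] [CommRing N']

theorem glMap_glMap (g : N →+* N') (f : S →+* N) (W : GL (Fin n) S) :
    Matrix.GeneralLinearGroup.map g (Matrix.GeneralLinearGroup.map f W) =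
      Matrix.GeneralLinearGroup.map (g.comp f) W :=
  rfl

theorem FundamentalMatrix.glMap_of_equivariant (Z : FundamentalMatrix A S) (τ : N →+* N)
    (ρ : S →ₐ[K] N) (hρ : ∀ s, ρ (σ s) = τ (ρ s)) :
    Matrix.GeneralLinearGroup.map τ (Matrix.GeneralLinearGroup.map (ρ : S →+* N) Z.mat) =
      Matrix.GeneralLinearGroup.map (algebraMap K N) A *
        Matrix.GeneralLinearGroup.map (ρ : S →+* N) Z.mat := by
  have h := congrArg (Matrix.GeneralLinearGroup.map (ρ : S →+* N)) Z.map_σ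
  rw [map_mul, glMap_glMap, glMap_glMap, AlgHom.comp_algebraMap] at h
  rw [← h, glMap_glMap]
  congr 1
  congr 1
  ext s
  exact (hρ s).symm

/-- The factors `W⁻¹` and `W` meet in the middle and cancel. -/
theorem glMap_inv_mul_eq (τ : N →+* N) {W X Y : GL (Fin n) N}
    (hX : Matrix.GeneralLinearGroup.map τ X = W * X)
    (hY : Matrix.GeneralLinearGroup.map τ Y = W * Y) :
    Matrix.GeneralLinearGroup.map τ (Y⁻¹ * X) = Y⁻¹ * X := by
  rw [map_mul, map_inv, hX, hY]
  group

/-- Both `Q` and `Q⁻¹` lift entrywise, and injectivity of `φ` lifts the relations saying that they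
are mutually inverse. -/
theorem exists_glMap_eq {B : Type*} [CommRing B] (φ : B →+* N) (hφ : Function.Injective φ)
    (Q : GL (Fin n) N) (h : ∀ i j, ∃ b, Q i j = φ b) (h' : ∀ i j, ∃ b, Q⁻¹ i j = φ b) :
    ∃ P : GL (Fin n) B, Q = Matrix.GeneralLinearGroup.map φ P := by
  choose P hP using h
  choose P' hP' using h'
  have e : φ.mapMatrix (Matrix.of P) = Q.1 := by
    ext i j
    exact (hP i j).symm
  have e' : φ.mapMatrix (Matrix.of P') = Q⁻¹.1 := by
    ext i j
    exact (hP' i j).symm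
  have hinj : Function.Injective (φ.mapMatrix : Matrix (Fin n) (Fin n) B → _) :=
    Matrix.map_injective hφ
  refine ⟨⟨Matrix.of P, Matrix.of P', hinj ?_, hinj ?_⟩, ?_⟩
  · rw [map_mul, e, e', map_one, Units.mul_inv]
  · rw [map_mul, e, e', map_one, Units.inv_mul]
  · exact Units.ext e.symm

theorem glMap_apply_eq (τ : N →+* N) {Q : GL (Fin n) N}
    (h : Matrix.GeneralLinearGroup.map τ Q = Q) (i j : Fin n) : τ (Q i j) = Q i j := by
  conv_rhs => rw [← h]
  rfl

end Matrix

/-! ### Equivariant homomorphisms into `M ⊗ B` -/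

section Tensor

variable {K : Type u} [Field K] [DifferenceRing K] {n : ℕ} {A : GL (Fin n) K}
  {S M : Type u} [CommRing S] [DifferenceRing S] [Algebra K S] [Extension K S]
  [CommRing M] [DifferenceRing M] [Algebra K M] [Extension K M]
  {B : Type u} [CommRing B] [Algebra (constants K) B]

/-- The inclusion of `M` in `M ⊗_C B`, as a homomorphism over `K`. -/
noncomputable abbrev inclLeft (K M B : Type u) [Field K] [DifferenceRing K] [CommRing M]
    [Algebra K M] [CommRing B] [Algebra (constants K) B] : M →ₐ[K] M ⊗[constants K] B :=
  Algebra.TensorProduct.includeLeft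

/-- The inclusion of `B` in `M ⊗_C B`. -/
noncomputable abbrev inclRight (K M B : Type u) [Field K] [DifferenceRing K] [CommRing M]
    [Algebra K M] [CommRing B] [Algebra (constants K) B] :
    B →ₐ[constants K] M ⊗[constants K] B :=
  Algebra.TensorProduct.includeRight

/-- An equivariant homomorphism `ρ : S → M ⊗_C B` sends a fundamental matrix of `S` to the product
of a fundamental matrix of `M` and a matrix in `GL_n(B)`. -/
theorem exists_glMap_eq_mul (Z : FundamentalMatrix A S) (V : FundamentalMatrix A M)
    [Nontrivial M] (hc : NoNewConstants K M) (ρ : S →ₐ[K] M ⊗[constants K] B)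
    (hρ : ∀ s, ρ (σ s) = σExt K M B (ρ s)) :
    ∃ P : GL (Fin n) B,
      Matrix.GeneralLinearGroup.map (ρ : S →+* M ⊗[constants K] B) Z.mat =
        Matrix.GeneralLinearGroup.map (inclLeft K M B : M →+* M ⊗[constants K] B) V.mat *
          Matrix.GeneralLinearGroup.map (inclRight K M B : B →+* M ⊗[constants K] B) P := by
  have hX := Z.glMap_of_equivariant (σExt K M B : M ⊗[constants K] B →+* _) ρ hρ
  have hY := V.glMap_of_equivariant (σExt K M B : M ⊗[constants K] B →+* _) (inclLeft K M B)
    fun m => rfl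
  have hQ := glMap_inv_mul_eq _ hX hY
  have hQ' := congrArg (·⁻¹) hQ
  simp only [← map_inv] at hQ'
  obtain ⟨P, hP⟩ := exists_glMap_eq (inclRight K M B : B →+* M ⊗[constants K] B)
    includeRight_injective _ (fun i j => exists_tmul_of_σExt_eq hc _ (glMap_apply_eq _ hQ i j))
    (fun i j => exists_tmul_of_σExt_eq hc _ (glMap_apply_eq _ hQ' i j))
  exact ⟨P, by rw [← hP, mul_inv_cancel_left]⟩

/-- The image of an equivariant homomorphism `S → M ⊗_C B` generates `M ⊗_C B` over `K` and `B`. -/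
theorem eq_top_of_range_le (Z : FundamentalMatrix A S) (V : FundamentalMatrix A M)
    (hV : V.ring = ⊤) [Nontrivial M] (hc : NoNewConstants K M)
    (ρ : S →ₐ[K] M ⊗[constants K] B) (hρ : ∀ s, ρ (σ s) = σExt K M B (ρ s))
    (X : Subalgebra K (M ⊗[constants K] B)) (hX : ∀ s, ρ s ∈ X) (hB : ∀ b : B, 1 ⊗ₜ b ∈ X) :
    X = ⊤ := by
  obtain ⟨P, hP⟩ := exists_glMap_eq_mul Z V hc ρ hρ
  have hM : ∀ m, inclLeft K M B m ∈ X.toSubring := by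
    refine V.apply_mem hV (inclLeft K M B : M →+* M ⊗[constants K] B)
      (fun a => X.algebraMap_mem a) ?_
    -- Solved for `V`: it is `ρ(Z)` times the inverse of a matrix over `B`, and both factors lie
    -- over `X`.
    rw [← mul_inv_eq_iff_eq_mul] at hP
    rw [← hP]
    exact mul_mem (map_mem_glSubgroup _ hX _) (inv_mem (map_mem_glSubgroup _ hB _))
  rw [eq_top_iff]
  rintro x -
  induction x with
  | zero => exact X.zero_mem
  | add x y hx hy => exact X.add_mem hx hy
  | tmul m b =>
    rw [tmul_eq]
    exact X.mul_mem (hM m) (hB b)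

theorem tensorMap_ext {N : Type*} [CommRing N] [Algebra K N] {f g : M ⊗[constants K] B →ₐ[K] N}
    (h : ∀ m, f (m ⊗ₜ 1) = g (m ⊗ₜ 1)) (h' : ∀ b, f (1 ⊗ₜ b) = g (1 ⊗ₜ b)) : f = g := by
  refine AlgHom.ext fun x => ?_
  induction x with
  | zero => rw [map_zero, map_zero]
  | add x y hx hy => rw [map_add, map_add, hx, hy]
  | tmul m b => rw [tmul_eq, map_mul, map_mul, h, h']

end Tensor

/-! ### The torsor of solutions and its coordinate algebra -/

section Torsor

variable {K : Type u} [Field K] [DifferenceRing K] {n : ℕ} {A : GL (Fin n) K}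

/-- The ring endomorphism `m ⊗ s ↦ σ m ⊗ σ s` of `M ⊗_K S`. -/
noncomputable def σTensor (K M S : Type*) [Field K] [DifferenceRing K] [CommRing M]
    [DifferenceRing M] [Algebra K M] [Extension K M] [CommRing S] [DifferenceRing S] [Algebra K S]
    [Extension K S] : M ⊗[K] S →+* M ⊗[K] S where
  toFun := TensorProduct.map (σSemilinear K M) (σSemilinear K S)
  map_one' := by simp [Algebra.TensorProduct.one_def, σSemilinear]
  map_mul' x y := by
    induction x with
    | zero => simp
    | add x₁ x₂ h₁ h₂ => rw [add_mul, map_add, h₁, h₂, map_add, add_mul]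
    | tmul a r =>
      induction y with
      | zero => simp
      | add y₁ y₂ h₁ h₂ => rw [mul_add, map_add, h₁, h₂, map_add, mul_add]
      | tmul b s => simp [σSemilinear]
  map_zero' := map_zero _
  map_add' := map_add _

variable {S M M' : Type u} [CommRing S] [DifferenceRing S] [Algebra K S] [Extension K S]
  [CommRing M] [DifferenceRing M] [Algebra K M] [Extension K M]
  [CommRing M'] [DifferenceRing M'] [Algebra K M'] [Extension K M']

theorem σTensor_tmul (m : M) (s : S) : σTensor K M S (m ⊗ₜ s) = (σ m) ⊗ₜ (σ s) := rfl

theorem σTensor_map (i : M →ₐ[K] M') (hi : ∀ m, i (σ m) = σ (i m)) (x : M ⊗[K] S) :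
    Algebra.TensorProduct.map i (AlgHom.id K S) (σTensor K M S x) =
      σTensor K M' S (Algebra.TensorProduct.map i (AlgHom.id K S) x) := by
  induction x with
  | zero => simp
  | add x y hx hy => simp only [map_add, hx, hy]
  | tmul m s => simp [σTensor_tmul, hi]

/-- The map `m ⊗ d ↦ (m ⊗ 1) g(d)` from `M ⊗_C D` to `M ⊗_K S`. -/
noncomputable def mulHom {D : Type u} [CommRing D] [Algebra (constants K) D]
    (g : D →ₐ[constants K] M ⊗[K] S) : M ⊗[constants K] D →ₐ[K] M ⊗[K] S :=
  Algebra.TensorProduct.lift (Algebra.TensorProduct.includeLeft : M →ₐ[K] M ⊗[K] S) g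
    fun _ _ => Commute.all _ _

section mulHom

variable {D : Type u} [CommRing D] [Algebra (constants K) D] (g : D →ₐ[constants K] M ⊗[K] S)

theorem mulHom_tmul (m : M) (d : D) : mulHom g (m ⊗ₜ d) = (m ⊗ₜ 1) * g d := by
  simp [mulHom]

theorem mulHom_σExt (hg : ∀ d, σTensor K M S (g d) = g d) (x : M ⊗[constants K] D) :
    mulHom g (σExt K M D x) = σTensor K M S (mulHom g x) := by
  induction x with
  | zero => simp
  | add x y hx hy => simp only [map_add, hx, hy]
  | tmul m d => rw [σExt_tmul, mulHom_tmul, mulHom_tmul, map_mul, hg, σTensor_tmul, map_one]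

theorem mulHom_injective_of_isSimple (hg : ∀ d, σTensor K M S (g d) = g d)
    (hg' : Function.Injective g) (hs : IsSimple M) (hc : NoNewConstants K M) :
    Function.Injective (mulHom g) := by
  refine injective_of_equivariant hs hc (σTensor K M S) (mulHom g : M ⊗[constants K] D →+* M ⊗[K] S)
    (mulHom_σExt g hg) fun d hd => ?_
  have h : mulHom g (1 ⊗ₜ d) = 0 := hd
  rw [mulHom_tmul, ← Algebra.TensorProduct.one_def, one_mul] at h
  exact hg' (by rw [h, map_zero])

/-- Simplicity is only required of an extension `M'` of `M`: tensoring over a field preserves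
injections, so injectivity over `M'` restricts to `M`. This serves for `T` inside `L`, before `T` is
known to be simple. -/
theorem mulHom_injective (hg : ∀ d, σTensor K M S (g d) = g d)
    (hg' : Function.Injective g) (i : M →ₐ[K] M') (hi : Function.Injective i)
    (hiσ : ∀ m, i (σ m) = σ (i m)) (hs : IsSimple M') (hc : NoNewConstants K M') :
    Function.Injective (mulHom g) := by
  let j : M ⊗[K] S →ₐ[K] M' ⊗[K] S := Algebra.TensorProduct.map i (AlgHom.id K S)
  have hj : Function.Injective j := Module.Flat.rTensor_preserves_injective_linearMap (M := S)
    i.toLinearMap hi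
  let g₂ : D →ₐ[constants K] M' ⊗[K] S := (j.restrictScalars (constants K)).comp g
  have h₂ : Function.Injective (mulHom g₂) := by
    refine mulHom_injective_of_isSimple g₂ (fun d => ?_) (hj.comp hg') hs hc
    change σTensor K M' S (j (g d)) = j (g d)
    rw [← σTensor_map i hiσ, hg]
  let e : M ⊗[constants K] D →ₐ[K] M' ⊗[constants K] D :=
    Algebra.TensorProduct.map i (AlgHom.id (constants K) D)
  have he : Function.Injective e := Module.Flat.rTensor_preserves_injective_linearMap (M := D)
    (i.restrictScalars (constants K)).toLinearMap hi
  have hcomp : j.comp (mulHom g) = (mulHom g₂).comp e := by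
    refine tensorMap_ext (fun m => ?_) fun d => ?_
    · simp [j, e, mulHom_tmul]
    · simp [j, e, mulHom_tmul, g₂, ← Algebra.TensorProduct.one_def]
  refine Function.Injective.of_comp (f := j) ?_
  have : j ∘ mulHom g = mulHom g₂ ∘ e := congrArg DFunLike.coe hcomp
  rw [this]
  exact h₂.comp he

end mulHom

/-- If `M` and `S` have fundamental matrices and `S = K[Z, 1/det Z]`, then `M ⊗_K S` is obtained
from `M` by an extension of constants. -/
theorem exists_mulHom_bijective (Z : FundamentalMatrix A S) (hZ : Z.ring = ⊤)
    (V : FundamentalMatrix A M) (i : M →ₐ[K] M') (hi : Function.Injective i)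
    (hiσ : ∀ m, i (σ m) = σ (i m)) (hs : IsSimple M') (hc : NoNewConstants K M') :
    ∃ D : Subalgebra (constants K) (M ⊗[K] S), D.FG ∧ (∀ d ∈ D, σTensor K M S d = d) ∧
      Function.Bijective (mulHom D.val) := by
  let l : M →ₐ[K] M ⊗[K] S := Algebra.TensorProduct.includeLeft
  let r : S →ₐ[K] M ⊗[K] S := Algebra.TensorProduct.includeRight
  have hX := Z.glMap_of_equivariant (σTensor K M S) r fun s => by
    change _ = (σ (1 : M)) ⊗ₜ[K] σ s
    rw [map_one]; rfl
  have hY := V.glMap_of_equivariant (σTensor K M S) l fun m => by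
    change _ = (σ m) ⊗ₜ[K] (σ (1 : S))
    rw [map_one]; rfl
  have hU := glMap_inv_mul_eq _ hX hY
  -- `U = V⁻¹ Z` is invariant, as a quotient of two solutions. The algebra `D` is generated by its
  -- entries and its inverse determinant.
  set U := (Matrix.GeneralLinearGroup.map (l : M →+* M ⊗[K] S) V.mat)⁻¹ *
    Matrix.GeneralLinearGroup.map (r : S →+* M ⊗[K] S) Z.mat with hUdef
  let G : Set (M ⊗[K] S) := Set.range (fun p : Fin n × Fin n => U p.1 p.2) ∪
    {((Matrix.GeneralLinearGroup.det U)⁻¹ : (M ⊗[K] S)ˣ).1}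
  let D := Algebra.adjoin (constants K) G
  have hD : ∀ d ∈ D, σTensor K M S d = d := by
    intro d hd
    induction hd using Algebra.adjoin_induction with
    | mem x hx =>
      rcases hx with ⟨p, rfl⟩ | rfl
      · exact glMap_apply_eq _ hU _ _
      · have h := congrArg (fun W => ((Matrix.GeneralLinearGroup.det W)⁻¹ : (M ⊗[K] S)ˣ).1) hU
        simp only [Matrix.GeneralLinearGroup.map_det, ← map_inv] at h
        rw [← map_inv]
        exact h
    | algebraMap c =>
      change (σ (algebraMap K M c)) ⊗ₜ[K] (σ (1 : S)) = (algebraMap K M c) ⊗ₜ[K] (1 : S)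
      rw [Extension.σ_algebraMap, mem_constants.1 c.2, map_one]
    | add x y _ _ hx hy => rw [map_add, hx, hy]
    | mul x y _ _ hx hy => rw [map_mul, hx, hy]
  refine ⟨D, Subalgebra.fg_def.2 ⟨G, (Set.finite_range _).union (Set.finite_singleton _), rfl⟩, hD,
    mulHom_injective _ (fun d => hD d d.2) Subtype.val_injective i hi hiσ hs hc, ?_⟩
  have hl : ∀ m, l m ∈ (mulHom D.val).range := fun m => (AlgHom.mem_range _).2 ⟨m ⊗ₜ 1, by
    rw [mulHom_tmul, map_one, mul_one]; rfl⟩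
  have hd : ∀ d : D, (d : M ⊗[K] S) ∈ (mulHom D.val).range := fun d => (AlgHom.mem_range _).2 ⟨1 ⊗ₜ d, by
    rw [mulHom_tmul, ← Algebra.TensorProduct.one_def, one_mul]; rfl⟩
  have hr : ∀ s, r s ∈ (mulHom D.val).range.toSubring := by
    refine Z.apply_mem hZ (r : S →+* M ⊗[K] S)
      (fun a => (AlgHom.commutes r a).symm ▸ Subalgebra.algebraMap_mem _ a) ?_
    -- Writing `Z = V U` puts `Z`, and with it the image of `S`, in the range.
    rw [← mul_inv_cancel_left (Matrix.GeneralLinearGroup.map (l : M →+* M ⊗[K] S) V.mat)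
      (Matrix.GeneralLinearGroup.map (r : S →+* M ⊗[K] S) Z.mat)]
    refine mul_mem (map_mem_glSubgroup _ hl _) ?_
    exact mem_glSubgroup (fun a b => hd ⟨_, Algebra.subset_adjoin (Or.inl ⟨(a, b), rfl⟩)⟩)
      (hd ⟨_, Algebra.subset_adjoin (Or.inr rfl)⟩)
  intro x
  change x ∈ (mulHom D.val).range
  induction x with
  | zero => exact Subalgebra.zero_mem _
  | add x y hx hy => exact Subalgebra.add_mem _ hx hy
  | tmul m s =>
    have : m ⊗ₜ[K] s = l m * r s := by simp [l, r]
    rw [this]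
    exact Subalgebra.mul_mem _ (hl m) (hr s)

/-- The functor of equivariant homomorphisms `S → M ⊗_C B` is represented by a finitely generated
algebra. -/
theorem exists_universal_hom (Z : FundamentalMatrix A S) (hZ : Z.ring = ⊤)
    (V : FundamentalMatrix A M) (hcM : NoNewConstants K M) (i : M →ₐ[K] M')
    (hi : Function.Injective i)
    (hiσ : ∀ m, i (σ m) = σ (i m)) (hs : IsSimple M') (hc : NoNewConstants K M') :
    ∃ (D : Type u) (_ : CommRing D) (_ : Algebra (constants K) D),
      Algebra.FiniteType (constants K) D ∧ (Nontrivial S → Nontrivial D) ∧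
      ∃ δ : S →ₐ[K] M ⊗[constants K] D, (∀ s, δ (σ s) = σExt K M D (δ s)) ∧
        ∀ (B : Type u) [CommRing B] [Algebra (constants K) B] (ρ : S →ₐ[K] M ⊗[constants K] B),
          (∀ s, ρ (σ s) = σExt K M B (ρ s)) →
            ∃! f : D →ₐ[constants K] B, ∀ s, tensorMap M f (δ s) = ρ s := by
  obtain ⟨D, hfg, hD, hbij⟩ := exists_mulHom_bijective Z hZ V i hi hiσ hs hc
  have := hs.1
  have : Nontrivial M := (i : M →+* M').domain_nontrivial
  let μ := AlgEquiv.ofBijective (mulHom D.val) hbij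
  let r : S →ₐ[K] M ⊗[K] S := Algebra.TensorProduct.includeRight
  have hμσ : ∀ x, μ (σExt K M D x) = σTensor K M S (μ x) := mulHom_σExt _ fun d => hD d d.2
  have hr : ∀ s, r (σ s) = σTensor K M S (r s) := fun s => by
    change _ = (σ (1 : M)) ⊗ₜ[K] σ s
    rw [map_one]; rfl
  -- The universal homomorphism is `s ↦ 1 ⊗ s` followed by the inverse of `M ⊗_C D ≃ M ⊗_K S`. If
  -- `S` is nonzero, so is `M ⊗_K S`, and therefore `D`.
  refine ⟨D, inferInstance, inferInstance, D.fg_iff_finiteType.1 hfg, fun _ => ?_,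
    (μ.symm : M ⊗[K] S →ₐ[K] M ⊗[constants K] D).comp r, fun s => ?_, ?_⟩
  · have : Nontrivial (M ⊗[K] S) := inferInstance
    infer_instance
  · change μ.symm (r (σ s)) = σExt K M D (μ.symm (r s))
    rw [AlgEquiv.symm_apply_eq, hμσ, AlgEquiv.apply_symm_apply, hr]
  · intro B _ _ ρ hρ
    let ρ' : M ⊗[K] S →ₐ[K] M ⊗[constants K] B :=
      Algebra.TensorProduct.lift (inclLeft K M B) ρ fun _ _ => Commute.all _ _
    have hρ't : ∀ m s, ρ' (m ⊗ₜ s) = (m ⊗ₜ 1) * ρ s := fun m s => by simp [ρ']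
    have hρ'σ : ∀ x, ρ' (σTensor K M S x) = σExt K M B (ρ' x) := by
      intro x
      induction x with
      | zero => simp
      | add x y hx hy => simp only [map_add, hx, hy]
      | tmul m s => rw [σTensor_tmul, hρ't, hρ't, map_mul, hρ, σExt_tmul]
    -- The `M`-linear extension `ρ'` sends the invariant elements `d` to invariants of `M ⊗ B`,
    -- which are the elements of `B`; this produces `f`.
    have hex : ∀ d : D, ∃ b : B, ρ' d = 1 ⊗ₜ b := fun d =>
      exists_tmul_of_σExt_eq hcM _ (by rw [← hρ'σ, hD d d.2])
    have hinj : Function.Injective (inclRight K M B) := includeRight_injective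
    let f : D →ₐ[constants K] B :=
      (AlgEquiv.ofInjective (inclRight K M B) hinj).symm.toAlgHom.comp
        (((ρ'.restrictScalars (constants K)).comp D.val).codRestrict (inclRight K M B).range
          fun d => (hex d).imp fun b hb => hb.symm)
    have hf : ∀ d : D, (1 : M) ⊗ₜ f d = ρ' d := by
      intro d
      have := AlgEquiv.apply_symm_apply (AlgEquiv.ofInjective (inclRight K M B) hinj)
        ((((ρ'.restrictScalars (constants K)).comp D.val).codRestrict (inclRight K M B).range
          fun d => (hex d).imp fun b hb => hb.symm) d)
      exact congrArg Subtype.val this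
    have hμd : ∀ d : D, μ (1 ⊗ₜ d) = d := fun d => by
      change mulHom D.val (1 ⊗ₜ d) = d
      rw [mulHom_tmul, ← Algebra.TensorProduct.one_def, one_mul]; rfl
    have hμm : ∀ m : M, μ (m ⊗ₜ 1) = m ⊗ₜ 1 := fun m => by
      change mulHom D.val (m ⊗ₜ 1) = m ⊗ₜ 1
      rw [mulHom_tmul, map_one, mul_one]
    refine ⟨f, fun s => ?_, fun f' hf' => ?_⟩
    · have h : tensorMap M f = ρ'.comp (μ : M ⊗[constants K] D →ₐ[K] M ⊗[K] S) := by
        refine tensorMap_ext (fun m => ?_) fun d => ?_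
        · change _ = ρ' (μ (m ⊗ₜ 1))
          rw [hμm, hρ't, map_one, mul_one]
          simp [tensorMap]
        · change _ = ρ' (μ (1 ⊗ₜ d))
          rw [hμd, ← hf]
          simp [tensorMap]
      rw [h]
      change ρ' (μ (μ.symm (r s))) = ρ s
      rw [AlgEquiv.apply_symm_apply]
      change ρ' (1 ⊗ₜ s) = ρ s
      rw [hρ't, ← Algebra.TensorProduct.one_def, one_mul]
    · have h : (tensorMap M f').comp (μ.symm : M ⊗[K] S →ₐ[K] M ⊗[constants K] D) = ρ' := by
        refine Algebra.TensorProduct.ext' fun m s => ?_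
        change tensorMap M f' (μ.symm (m ⊗ₜ s)) = _
        have : μ.symm (m ⊗ₜ s) = (m ⊗ₜ 1) * μ.symm (r s) := by
          rw [AlgEquiv.symm_apply_eq, map_mul, hμm, AlgEquiv.apply_symm_apply]
          simp [r]
        have h' : tensorMap M f' (μ.symm (r s)) = ρ s := hf' s
        rw [this, map_mul, h', hρ't]
        simp [tensorMap]
      refine AlgHom.ext fun d => hinj ?_
      change (1 : M) ⊗ₜ f' d = (1 : M) ⊗ₜ f d
      rw [hf, ← h]
      change _ = tensorMap M f' (μ.symm d)
      rw [← hμd, AlgEquiv.symm_apply_apply]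
      simp [tensorMap]

end Torsor

/-! ### Representability of the Galois group -/

section Representability

variable {K : Type u} [Field K] [DifferenceRing K] {n : ℕ} {A : GL (Fin n) K}
  {S M : Type u} [CommRing S] [DifferenceRing S] [Algebra K S] [Extension K S]
  [CommRing M] [DifferenceRing M] [Algebra K M] [Extension K M]
  {B : Type u} [CommRing B] [Algebra (constants K) B]

/-- The `B`-linear extension `S ⊗_C B → M ⊗_C B` of a homomorphism `S → M ⊗_C B`. -/
noncomputable def linearExtend (ρ : S →ₐ[K] M ⊗[constants K] B) :
    S ⊗[constants K] B →ₐ[K] M ⊗[constants K] B :=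
  Algebra.TensorProduct.lift ρ (inclRight K M B) fun _ _ => Commute.all _ _

variable (ρ : S →ₐ[K] M ⊗[constants K] B)

theorem linearExtend_tmul (s : S) (b : B) : linearExtend ρ (s ⊗ₜ b) = ρ s * (1 ⊗ₜ b) := by
  simp [linearExtend]

theorem linearExtend_tmul_one (s : S) : linearExtend ρ (s ⊗ₜ 1) = ρ s := by
  rw [linearExtend_tmul, ← Algebra.TensorProduct.one_def, mul_one]

theorem linearExtend_one_tmul (b : B) : linearExtend ρ (1 ⊗ₜ b) = 1 ⊗ₜ b := by
  rw [linearExtend_tmul, map_one, one_mul]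

theorem linearExtend_σExt (hρ : ∀ s, ρ (σ s) = σExt K M B (ρ s)) (x : S ⊗[constants K] B) :
    linearExtend ρ (σExt K S B x) = σExt K M B (linearExtend ρ x) := by
  induction x with
  | zero => simp
  | add x y hx hy => simp only [map_add, hx, hy]
  | tmul s b =>
    rw [σExt_tmul, linearExtend_tmul, linearExtend_tmul, map_mul, hρ, σExt_tmul, map_one]

theorem linearExtend_surjective (Z : FundamentalMatrix A S) (V : FundamentalMatrix A M)
    (hV : V.ring = ⊤) [Nontrivial M] (hc : NoNewConstants K M)
    (hρ : ∀ s, ρ (σ s) = σExt K M B (ρ s)) : Function.Surjective (linearExtend ρ) := by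
  rw [← AlgHom.range_eq_top]
  exact eq_top_of_range_le Z V hV hc ρ hρ _
    (fun s => (AlgHom.mem_range _).2 ⟨s ⊗ₜ 1, linearExtend_tmul_one ρ s⟩)
    fun b => (AlgHom.mem_range _).2 ⟨1 ⊗ₜ b, linearExtend_one_tmul ρ b⟩

/-- Every equivariant homomorphism `M → M ⊗_C B` comes from a point of the Galois group. -/
theorem exists_galoisPoint (V : FundamentalMatrix A M) (hV : V.ring = ⊤) (hs : IsSimple M)
    (hc : NoNewConstants K M) (ρ : M →ₐ[K] M ⊗[constants K] B)
    (hρ : ∀ s, ρ (σ s) = σExt K M B (ρ s)) :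
    ∃ φ : galoisPoints K M B, ∀ m, φ.1 (m ⊗ₜ 1) = ρ m := by
  have := hs.1
  refine ⟨⟨AlgEquiv.ofBijective (linearExtend ρ) ⟨?_, linearExtend_surjective ρ V V hV hc hρ⟩,
    linearExtend_one_tmul ρ, linearExtend_σExt ρ hρ⟩, linearExtend_tmul_one ρ⟩
  refine injective_of_equivariant hs hc
    (σExt K M B : M ⊗[constants K] B →+* M ⊗[constants K] B)
    (linearExtend ρ : M ⊗[constants K] B →+* M ⊗[constants K] B) (linearExtend_σExt ρ hρ)
    fun b hb => eq_zero_of_one_tmul_eq_zero (K := K) (M := M) ?_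
  rw [← linearExtend_one_tmul ρ]
  exact hb

theorem galoisPoints_ext {φ ψ : galoisPoints K M B} (h : ∀ m, φ.1 (m ⊗ₜ 1) = ψ.1 (m ⊗ₜ 1)) :
    φ = ψ := by
  refine Subtype.ext (AlgEquiv.ext fun x => ?_)
  induction x with
  | zero => rw [map_zero, map_zero]
  | add x y hx hy => rw [map_add, map_add, hx, hy]
  | tmul m b => rw [tmul_eq, map_mul, map_mul, h, φ.2.1, ψ.2.1]

theorem galoisMap_tmul_one {B' : Type u} [CommRing B'] [Algebra (constants K) B']
    (f : B →ₐ[constants K] B') (φ : galoisPoints K M B) (m : M) :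
    (galoisMap f φ).1 (m ⊗ₜ 1) = tensorMap M f (φ.1 (m ⊗ₜ 1)) := by
  change extendHom f φ.1 (m ⊗ₜ 1) = _
  rw [extendHom_tmul, ← Algebra.TensorProduct.one_def, mul_one]

/-- The Galois group of a Picard-Vessiot ring without new constants is a linear algebraic group. -/
theorem isLinearAlgebraicGroup_galoisGroup (V : FundamentalMatrix A M) (hV : V.ring = ⊤)
    (hs : IsSimple M) (hc : NoNewConstants K M) : IsLinearAlgebraicGroup (galoisGroup K M) := by
  obtain ⟨D, _, _, hfin, -, δ, hδ, huniv⟩ := exists_universal_hom V hV V hc (AlgHom.id K M)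
    Function.injective_id (fun _ => rfl) hs hc
  -- For `S = M` the universal homomorphism is itself a `D`-point of the Galois group, and every
  -- point is obtained from it by a unique base change.
  obtain ⟨g, hg⟩ := exists_galoisPoint V hV hs hc δ hδ
  have key : ∀ (B : Type u) [CommRing B] [Algebra (constants K) B] (φ : galoisPoints K M B),
      ∃! f : D →ₐ[constants K] B, galoisMap f g = φ := by
    intro B _ _ φ
    obtain ⟨f, hf, hf'⟩ := huniv B ((φ.1 : _ →ₐ[K] _).comp (inclLeft K M B)) fun m => by
      change φ.1 ((σ m) ⊗ₜ 1) = σExt K M B (φ.1 (m ⊗ₜ 1))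
      rw [← φ.2.2, σExt_tmul]
    refine ⟨f, galoisPoints_ext fun m => ?_, fun f' h => hf' f' fun m => ?_⟩
    · rw [galoisMap_tmul_one, hg, hf]
      rfl
    · rw [← hg, ← galoisMap_tmul_one, h]
      rfl
  refine ⟨CommAlgCat.of _ D, hfin, ⟨⟨fun {Y} => Equiv.ofBijective
    (fun f => (galoisMap f.hom g : galoisPoints K M Y)) ⟨fun f f' h => ?_, fun φ => ?_⟩, ?_⟩⟩⟩
  · exact CommAlgCat.hom_ext ((key Y _).unique h rfl)
  · obtain ⟨f, hf, -⟩ := key Y φ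
    exact ⟨CommAlgCat.ofHom f, hf⟩
  · intro Y Y' h f
    exact galoisMap_comp h.hom f.hom g

end Representability

/-! ### Extension of the base field from `k` to `K` -/

section BaseChangeHom

variable {k K R : Type u} [Field k] [DifferenceRing k] [Field K] [DifferenceRing K] [Algebra k K]
  [Extension k K] [CommRing R] [DifferenceRing R] [Algebra k R] [Extension k R]

theorem BaseChange.mk_mul (a b : K) (r s : R) :
    mk k a r * mk k b s = mk k (a * b) (r * s) :=
  Algebra.TensorProduct.tmul_mul_tmul a b r s

theorem BaseChange.mk_eq (a : K) (r : R) :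
    mk k a r = algebraMap K (BaseChange k K R) a * mk k 1 r := by
  rw [algebraMap_eq, mk_mul, mul_one, one_mul]

theorem BaseChange.induction {P : BaseChange k K R → Prop} (zero : P 0)
    (add : ∀ x y, P x → P y → P (x + y)) (mk : ∀ a r, P (mk k a r)) (x : BaseChange k K R) :
    P x :=
  TensorProduct.induction_on (motive := P) x zero mk add

instance [Nontrivial R] : Nontrivial (BaseChange k K R) :=
  inferInstanceAs (Nontrivial (K ⊗[k] R))

variable (k K R) in
/-- The homomorphism `r ↦ 1 ⊗ r` from `R` to `K ⊗_k R`. -/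
noncomputable def BaseChange.incl : R →+* BaseChange k K R :=
  ((Algebra.TensorProduct.includeRight : R →ₐ[k] K ⊗[k] R) : R →+* K ⊗[k] R)

theorem BaseChange.incl_apply (r : R) : incl k K R r = mk k 1 r := rfl

theorem BaseChange.incl_algebraMap (a : k) :
    incl k K R (algebraMap k R a) = algebraMap K _ (algebraMap k K a) := by
  rw [incl_apply, algebraMap_eq]
  change (1 : K) ⊗ₜ[k] algebraMap k R a = algebraMap k K a ⊗ₜ[k] (1 : R)
  rw [Algebra.algebraMap_eq_smul_one, Algebra.algebraMap_eq_smul_one, TensorProduct.smul_tmul]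

/-- The `K`-linear extension to `K ⊗_k R` of a homomorphism out of `R`. -/
noncomputable def BaseChange.lift {N : Type*} [CommRing N] [Algebra K N] (g : R →+* N)
    (hg : ∀ a, g (algebraMap k R a) = algebraMap K N (algebraMap k K a)) :
    BaseChange k K R →ₐ[K] N :=
  letI : Algebra k N := Algebra.compHom N (algebraMap k K)
  haveI : IsScalarTower k K N := IsScalarTower.of_algebraMap_eq fun _ => rfl
  (Algebra.TensorProduct.lift (Algebra.ofId K N) ({ g with commutes' := hg } : R →ₐ[k] N)
    fun _ _ => Commute.all _ _ : K ⊗[k] R →ₐ[K] N)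

theorem BaseChange.lift_mk {N : Type*} [CommRing N] [Algebra K N] (g : R →+* N)
    (hg : ∀ a, g (algebraMap k R a) = algebraMap K N (algebraMap k K a)) (a : K) (r : R) :
    lift g hg (mk k a r) = algebraMap K N a * g r :=
  rfl

theorem BaseChange.lift_σ {N : Type*} [CommRing N] [Algebra K N] (g : R →+* N)
    (hg : ∀ a, g (algebraMap k R a) = algebraMap K N (algebraMap k K a)) (τ : N →+* N)
    (hτ : ∀ a, τ (algebraMap K N a) = algebraMap K N (σ a)) (hgσ : ∀ r, g (σ r) = τ (g r))
    (x : BaseChange k K R) : lift g hg (σ x) = τ (lift g hg x) := by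
  induction x using BaseChange.induction with
  | zero => simp
  | add x y hx hy => simp only [map_add, hx, hy]
  | mk a r => rw [σ_mk, lift_mk, lift_mk, map_mul, hτ, hgσ]

variable {n : ℕ} {A : GL (Fin n) k}

variable (K) in
/-- The fundamental matrix of `K ⊗_k R` defined by a fundamental matrix of `R`. -/
noncomputable def FundamentalMatrix.baseChange (Z : FundamentalMatrix A R) :
    FundamentalMatrix (Matrix.GeneralLinearGroup.map (algebraMap k K) A) (BaseChange k K R) where
  mat := Matrix.GeneralLinearGroup.map (BaseChange.incl k K R) Z.mat
  map_σ := by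
    have h := congrArg (Matrix.GeneralLinearGroup.map (BaseChange.incl k K R)) Z.map_σ
    rw [map_mul, glMap_glMap, glMap_glMap] at h
    rw [glMap_glMap, glMap_glMap]
    have h1 : (BaseChange.incl k K R).comp (algebraMap k R) =
        (algebraMap K (BaseChange k K R)).comp (algebraMap k K) :=
      RingHom.ext BaseChange.incl_algebraMap
    have h2 : (BaseChange.incl k K R).comp ((σ : R ≃+* R) : R →+* R) =
        ((σ : BaseChange k K R ≃+* BaseChange k K R) : BaseChange k K R →+* _).comp
          (BaseChange.incl k K R) := by
      ext r
      change BaseChange.mk k (1 : K) (σ r) = σ (BaseChange.mk k (1 : K) r)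
      rw [BaseChange.σ_mk, map_one]
    rw [← h1, ← h2, h]

theorem FundamentalMatrix.baseChange_ring (Z : FundamentalMatrix A R) (hZ : Z.ring = ⊤) :
    (Z.baseChange K).ring = ⊤ := by
  have h : ∀ r, BaseChange.incl k K R r ∈ (Z.baseChange K).ring.toSubring := by
    refine Z.apply_mem hZ (BaseChange.incl k K R) (fun a => ?_) ?_
    · rw [BaseChange.incl_algebraMap]
      exact Subalgebra.algebraMap_mem _ _
    · exact mem_glSubgroup (fun i j => (Z.baseChange K).entry_mem i j) (Z.baseChange K).det_inv_mem
  rw [eq_top_iff]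
  rintro x -
  induction x using BaseChange.induction with
  | zero => exact Subalgebra.zero_mem _
  | add x y hx hy => exact Subalgebra.add_mem _ hx hy
  | mk a r =>
    rw [BaseChange.mk_eq]
    exact Subalgebra.mul_mem _ (Subalgebra.algebraMap_mem _ a) (h r)

/-- The homomorphism from `R ⊗_C B` given by homomorphisms on `R` and on `B`. -/
noncomputable def tensorLift {B N : Type u} [CommRing B] [Algebra (constants k) B] [CommRing N]
    (g : R →+* N) (h : B →+* N)
    (hgh : ∀ c : constants k, h (algebraMap (constants k) B c) = g (algebraMap k R c)) :
    R ⊗[constants k] B →+* N :=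
  letI : Algebra (constants k) N := (g.comp (algebraMap (constants k) R)).toAlgebra
  (Algebra.TensorProduct.lift ({ g with commutes' := fun _ => rfl } : R →ₐ[constants k] N)
    ({ h with commutes' := hgh } : B →ₐ[constants k] N) fun _ _ => Commute.all _ _ :
      R ⊗[constants k] B →ₐ[constants k] N)

/-! ### Comparison of `R ⊗_{C_k} B` with `(K ⊗_k R) ⊗_{C_K} B` -/

section ConstantExtension

variable {B : Type u} [CommRing B] [Algebra (constants k) B] [Algebra (constants K) B]
  [IsScalarTower (constants k) (constants K) B]

theorem algebraMap_constants_tmul (M : Type u) [CommRing M] [Algebra K M] (c : constants k) :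
    (algebraMap K M (algebraMap k K c)) ⊗ₜ[constants K] (1 : B) =
      1 ⊗ₜ[constants K] algebraMap (constants k) B c := by
  have h : algebraMap K M (algebraMap k K c) =
      algebraMap (constants K) M (algebraMap (constants k) (constants K) c) := rfl
  rw [h, IsScalarTower.algebraMap_apply (constants k) (constants K) B,
    Algebra.algebraMap_eq_smul_one, Algebra.algebraMap_eq_smul_one (A := B),
    TensorProduct.smul_tmul]

variable (k K R B) in
/-- The natural homomorphism `R ⊗_{C_k} B → (K ⊗_k R) ⊗_{C_K} B`. -/
noncomputable def constExtHom :
    R ⊗[constants k] B →+* BaseChange k K R ⊗[constants K] B :=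
  tensorLift ((inclLeft K (BaseChange k K R) B : _ →+* _).comp (BaseChange.incl k K R))
    (inclRight K (BaseChange k K R) B : B →+* _) fun c => by
      change (1 : BaseChange k K R) ⊗ₜ[constants K] _ =
        (BaseChange.incl k K R (algebraMap k R c)) ⊗ₜ[constants K] (1 : B)
      rw [BaseChange.incl_algebraMap, algebraMap_constants_tmul]

theorem constExtHom_tmul (r : R) (b : B) :
    constExtHom k K R B (r ⊗ₜ b) = BaseChange.mk k 1 r ⊗ₜ b := by
  change (BaseChange.mk k (1 : K) r ⊗ₜ[constants K] (1 : B)) * (1 ⊗ₜ[constants K] b) = _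
  simp

theorem constExtHom_σExt (x : R ⊗[constants k] B) :
    constExtHom k K R B (σExt k R B x) =
      σExt K (BaseChange k K R) B (constExtHom k K R B x) := by
  induction x with
  | zero => simp
  | add x y hx hy => simp only [map_add, hx, hy]
  | tmul r b => rw [σExt_tmul, constExtHom_tmul, constExtHom_tmul, σExt_tmul, BaseChange.σ_mk,
      map_one]

/-- A scalar in `k` is absorbed by `R`, and a constant of `K` moves across the tensor sign into `B`.
-/
theorem smul_mem_range_constExtHom {a : K} (ha : a ∈ Algebra.adjoin k (constants K : Set K))
    (y : R ⊗[constants k] B) :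
    algebraMap K _ a * constExtHom k K R B y ∈ (constExtHom k K R B).range := by
  induction ha using Algebra.adjoin_induction generalizing y with
  | mem c hc =>
    induction y with
    | zero => exact ⟨0, by simp⟩
    | add x y hx hy => rw [map_add, mul_add]; exact Subring.add_mem _ hx hy
    | tmul r b =>
      refine ⟨r ⊗ₜ ((⟨c, hc⟩ : constants K) • b), ?_⟩
      rw [constExtHom_tmul, constExtHom_tmul, ← TensorProduct.smul_tmul,
        Algebra.TensorProduct.algebraMap_apply, Algebra.TensorProduct.tmul_mul_tmul, one_mul,
        Algebra.smul_def]
      rfl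
  | algebraMap c =>
    refine ⟨algebraMap k R c ⊗ₜ 1 * y, ?_⟩
    rw [map_mul, constExtHom_tmul, ← BaseChange.incl_apply, BaseChange.incl_algebraMap]
    rfl
  | add a b _ _ ha hb => rw [map_add, add_mul]; exact Subring.add_mem _ (ha y) (hb y)
  | mul a b _ _ ha hb =>
    obtain ⟨z, hz⟩ := hb y
    rw [map_mul, mul_assoc, ← hz]
    exact ha z

/-- If `K = k(C_K)` then `(K ⊗_k R) ⊗_{C_K} B` is a localization of the image of `R ⊗_{C_k} B`. -/
theorem exists_algebraMap_mul_eq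
    (hK : IntermediateField.adjoin k (constants K : Set K) = ⊤)
    (x : BaseChange k K R ⊗[constants K] B) :
    ∃ a ∈ Algebra.adjoin k (constants K : Set K), a ≠ 0 ∧ ∃ y : R ⊗[constants k] B,
      algebraMap K _ a * x = constExtHom k K R B y := by
  induction x with
  | zero => exact ⟨1, Subalgebra.one_mem _, one_ne_zero, 0, by simp⟩
  | add x₁ x₂ h₁ h₂ =>
    obtain ⟨a₁, ha₁, h0₁, y₁, hy₁⟩ := h₁
    obtain ⟨a₂, ha₂, h0₂, y₂, hy₂⟩ := h₂
    refine ⟨a₁ * a₂, Subalgebra.mul_mem _ ha₁ ha₂, mul_ne_zero h0₁ h0₂, ?_⟩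
    obtain ⟨z₁, hz₁⟩ := smul_mem_range_constExtHom ha₂ y₁
    obtain ⟨z₂, hz₂⟩ := smul_mem_range_constExtHom ha₁ y₂
    refine ⟨z₁ + z₂, ?_⟩
    rw [map_add, hz₁, hz₂, ← hy₁, ← hy₂, map_mul]
    ring
  | tmul s b =>
    induction s using BaseChange.induction with
    | zero => exact ⟨1, Subalgebra.one_mem _, one_ne_zero, 0, by simp⟩
    | add x₁ x₂ h₁ h₂ =>
      obtain ⟨a₁, ha₁, h0₁, y₁, hy₁⟩ := h₁
      obtain ⟨a₂, ha₂, h0₂, y₂, hy₂⟩ := h₂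
      refine ⟨a₁ * a₂, Subalgebra.mul_mem _ ha₁ ha₂, mul_ne_zero h0₁ h0₂, ?_⟩
      obtain ⟨z₁, hz₁⟩ := smul_mem_range_constExtHom ha₂ y₁
      obtain ⟨z₂, hz₂⟩ := smul_mem_range_constExtHom ha₁ y₂
      refine ⟨z₁ + z₂, ?_⟩
      rw [map_add, hz₁, hz₂, ← hy₁, ← hy₂, map_mul, TensorProduct.add_tmul]
      ring
    | mk a r =>
      have ha : a ∈ IntermediateField.adjoin k (constants K : Set K) :=
        hK ▸ IntermediateField.mem_top
      obtain ⟨p, hp, q, hq, rfl⟩ := IntermediateField.mem_adjoin_iff_div.1 ha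
      -- The description of the adjoined field by quotients `p / q` allows `q = 0`, where the
      -- quotient is `0`. Otherwise `q` clears the denominator.
      rcases eq_or_ne q 0 with rfl | hq0
      · exact ⟨1, Subalgebra.one_mem _, one_ne_zero, 0, by
          rw [div_zero, BaseChange.mk_eq]; simp⟩
      · obtain ⟨y, hy⟩ := smul_mem_range_constExtHom (K := K) hp (r ⊗ₜ b)
        refine ⟨q, hq, hq0, y, ?_⟩
        rw [hy, constExtHom_tmul, Algebra.TensorProduct.algebraMap_apply,
          Algebra.TensorProduct.algebraMap_apply, Algebra.TensorProduct.tmul_mul_tmul,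
          Algebra.TensorProduct.tmul_mul_tmul, BaseChange.mk_eq (p / q), ← mul_assoc, ← map_mul,
          mul_div_cancel₀ _ hq0]

/-- On `B` the composite agrees with `Ψ`, so the injectivity principle for `R` over `k` applies;
nothing is needed about how `K` is generated. -/
theorem comp_constExtHom_injective (hs : IsSimple R) (hc : NoNewConstants k R)
    {N : Type*} [CommRing N] (τ : N →+* N) (Ψ : BaseChange k K R ⊗[constants K] B →+* N)
    (hΨ : ∀ x, Ψ (σExt K (BaseChange k K R) B x) = τ (Ψ x)) (hB : ∀ b : B, Ψ (1 ⊗ₜ b) = 0 → b = 0) :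
    Function.Injective (Ψ.comp (constExtHom k K R B)) := by
  refine injective_of_equivariant hs hc τ (Ψ.comp (constExtHom k K R B)) (fun x => ?_) fun b hb =>
    hB b ?_
  · rw [RingHom.comp_apply, constExtHom_σExt, hΨ]
    rfl
  · rw [← hb, RingHom.comp_apply, constExtHom_tmul]
    rfl

/-- If `K = k(C_K)` and `R` is simple without new constants, an equivariant homomorphism out of
`(K ⊗_k R) ⊗_{C_K} B` is injective as soon as it is injective on `B`. -/
theorem injective_of_equivariant_baseChange
    (hK : IntermediateField.adjoin k (constants K : Set K) = ⊤)
    (hs : IsSimple R) (hc : NoNewConstants k R)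
    {N : Type*} [CommRing N] (τ : N →+* N) (Ψ : BaseChange k K R ⊗[constants K] B →+* N)
    (hΨ : ∀ x, Ψ (σExt K (BaseChange k K R) B x) = τ (Ψ x)) (hB : ∀ b : B, Ψ (1 ⊗ₜ b) = 0 → b = 0) :
    Function.Injective Ψ := by
  rw [injective_iff_map_eq_zero]
  intro x hx
  -- An element of the kernel, multiplied by a nonzero `a` in `K`, comes from some `y` in `R ⊗ B`.
  -- The composite kills `y`, so `y = 0`, and `a` is a unit.
  obtain ⟨a, -, ha, y, hy⟩ := exists_algebraMap_mul_eq hK x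
  have hy0 : y = 0 := by
    refine comp_constExtHom_injective hs hc τ Ψ hΨ hB ?_
    rw [RingHom.comp_apply, ← hy, map_mul, hx, mul_zero, map_zero]
  rw [hy0, map_zero] at hy
  exact ((IsUnit.mk0 a ha).map (algebraMap K _)).mul_right_eq_zero.1 hy

end ConstantExtension

end BaseChangeHom

/-! ### The ring generated by a fundamental matrix -/

section Subring

variable {K : Type*} [Field K] [DifferenceRing K] {n : ℕ} {A : GL (Fin n) K}
  {L : Type*} [CommRing L] [DifferenceRing L] [Algebra K L] [Extension K L]

theorem FundamentalMatrix.exists_ring_eq_top (V : FundamentalMatrix A L) :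
    ∃ V' : FundamentalMatrix A V.ring, V'.ring = ⊤ := by
  obtain ⟨W, hW⟩ : V.mat ∈ glSubgroup n V.ring.toSubring := mem_glSubgroup V.entry_mem V.det_inv_mem
  let W' : GL (Fin n) V.ring := W
  have hW' : Matrix.GeneralLinearGroup.map (V.ring.val : V.ring →+* L) W' = V.mat := hW
  have hinj : Function.Injective
      (Matrix.GeneralLinearGroup.map (n := Fin n) (V.ring.val : V.ring →+* L)) := fun X Y h =>
    Units.ext (Matrix.map_injective (f := (V.ring.val : V.ring → L)) Subtype.val_injective
      (congrArg Units.val h))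
  let V' : FundamentalMatrix A V.ring := ⟨W', hinj (by
    have h := V.map_σ
    rw [← hW'] at h
    rw [map_mul]
    exact h)⟩
  refine ⟨V', eq_top_iff.2 ?_⟩
  have hle : V.ring ≤ V'.ring.map V.ring.val := by
    refine Algebra.adjoin_le ?_
    rw [← hW']
    rintro _ (⟨p, rfl⟩ | rfl)
    · exact ⟨_, V'.entry_mem p.1 p.2, rfl⟩
    · refine ⟨_, V'.det_inv_mem, ?_⟩
      rw [Matrix.GeneralLinearGroup.map_det, ← map_inv]
      rfl
  rintro ⟨x, hx⟩ -
  obtain ⟨y, hy, hyx⟩ := hle hx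
  have : y = ⟨x, hx⟩ := Subtype.ext hyx
  rwa [← this]

theorem FundamentalMatrix.noNewConstants_ring (V : FundamentalMatrix A L)
    (hc : NoNewConstants K L) : NoNewConstants K V.ring := fun x hx => by
  obtain ⟨c, hcK, hcx⟩ := hc x (congrArg Subtype.val hx)
  exact ⟨c, hcK, Subtype.ext hcx⟩

end Subring

/-- Nullstellensatz: a residue field of `D` is finite over `C`, so it embeds in `F`. -/
theorem nonempty_algHom_of_isAlgClosed (C D F : Type*) [Field C] [CommRing D] [Algebra C D]
    [Algebra.FiniteType C D] [Nontrivial D] [Field F] [IsAlgClosed F] [Algebra C F] :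
    Nonempty (D →ₐ[C] F) := by
  obtain ⟨m, hm⟩ := Ideal.exists_maximal D
  let _ : Field (D ⧸ m) := Ideal.Quotient.field m
  have : Algebra.FiniteType C (D ⧸ m) :=
    Algebra.FiniteType.of_surjective (Ideal.Quotient.mkₐ C m) (Ideal.Quotient.mkₐ_surjective C m)
  have : Module.Finite C (D ⧸ m) := finite_of_finite_type_of_isJacobsonRing C (D ⧸ m)
  exact ⟨(IsAlgClosed.lift : D ⧸ m →ₐ[C] F).comp (Ideal.Quotient.mkₐ C m)⟩

/-! ### The isomorphism over `F` and simplicity of `T` -/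

section Comparison

variable {k K R T : Type u} [Field k] [DifferenceRing k] [Field K] [DifferenceRing K] [Algebra k K]
  [Extension k K] [CommRing R] [DifferenceRing R] [Algebra k R] [Extension k R]
  [CommRing T] [DifferenceRing T] [Algebra K T] [Extension K T] {n : ℕ} {A : GL (Fin n) k}
  {F : Type u} [Field F] [Algebra (constants k) F] [Algebra (constants K) F]
  [IsScalarTower (constants k) (constants K) F]

/-- Over an algebraically closed field of constants, a Picard-Vessiot ring over `k` becomes
isomorphic to a ring `T = K[V, 1/det V]` contained in a simple extension without new constants. -/
theorem exists_equiv_tensor [IsAlgClosed F]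
    (hK : IntermediateField.adjoin k (constants K : Set K) = ⊤)
    (Z : FundamentalMatrix A R) (hZ : Z.ring = ⊤) (hs : IsSimple R) (hc : NoNewConstants k R)
    (V : FundamentalMatrix (Matrix.GeneralLinearGroup.map (algebraMap k K) A) T) (hV : V.ring = ⊤)
    (hcT : NoNewConstants K T) {L : Type u} [CommRing L] [DifferenceRing L] [Algebra K L]
    [Extension K L] (i : T →ₐ[K] L) (hi : Function.Injective i) (hiσ : ∀ t, i (σ t) = σ (i t))
    (hsL : IsSimple L) (hcL : NoNewConstants K L) :
    ∃ Φ : BaseChange k K R ⊗[constants K] F ≃ₐ[K] T ⊗[constants K] F,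
      (∀ c : F, Φ (1 ⊗ₜ c) = 1 ⊗ₜ c) ∧
        ∀ x, Φ (σExt K (BaseChange k K R) F x) = σExt K T F (Φ x) := by
  have := hs.1
  have := hsL.1
  have : Nontrivial T := (i : T →+* L).domain_nontrivial
  -- `D` is the coordinate algebra of the equivariant homomorphisms `K ⊗ R → T ⊗ B`. An `F`-point of
  -- it specializes `δ` to a homomorphism into `T ⊗ F`.
  obtain ⟨D, _, _, _, hD, δ, hδ, -⟩ := exists_universal_hom (Z.baseChange K)
    (Z.baseChange_ring hZ) V hcT i hi hiσ hsL hcL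
  have := hD inferInstance
  obtain ⟨f⟩ := nonempty_algHom_of_isAlgClosed (constants K) D F
  let ρ : BaseChange k K R →ₐ[K] T ⊗[constants K] F := (tensorMap T f).comp δ
  have hρ : ∀ s, ρ (σ s) = σExt K T F (ρ s) := fun s => by
    change tensorMap T f (δ (σ s)) = σExt K T F (tensorMap T f (δ s))
    rw [hδ, tensorMap_σExt]
  refine ⟨AlgEquiv.ofBijective (linearExtend ρ) ⟨?_, linearExtend_surjective ρ (Z.baseChange K) V hV
    hcT hρ⟩, linearExtend_one_tmul ρ, linearExtend_σExt ρ hρ⟩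
  refine injective_of_equivariant_baseChange hK hs hc
    (σExt K T F : T ⊗[constants K] F →+* T ⊗[constants K] F)
    (linearExtend ρ : BaseChange k K R ⊗[constants K] F →+* T ⊗[constants K] F)
    (linearExtend_σExt ρ hρ) fun b hb => eq_zero_of_one_tmul_eq_zero (K := K) (M := T) ?_
  rw [← linearExtend_one_tmul ρ]
  exact hb

variable (Φ : BaseChange k K R ⊗[constants K] F ≃ₐ[K] T ⊗[constants K] F)

/-- After tensoring with `F`, the source is identified by `Φ` with `(K ⊗ R) ⊗ F`, and `F` embeds in
`Q ⊗ F` since `Q` is nonzero. So `p ⊗ F` is injective, and `T` embeds in `T ⊗ F`. The map `s` may be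
any ring endomorphism, so the lemma applies to a quotient without checking that the induced map is
bijective. -/
theorem injective_of_equiv_tensor (hK : IntermediateField.adjoin k (constants K : Set K) = ⊤)
    (hs : IsSimple R) (hc : NoNewConstants k R) (hΦ : ∀ c : F, Φ (1 ⊗ₜ c) = 1 ⊗ₜ c)
    (hΦσ : ∀ x, Φ (σExt K (BaseChange k K R) F x) = σExt K T F (Φ x))
    {Q : Type u} [CommRing Q] [Algebra K Q] [Nontrivial Q] (p : T →ₐ[K] Q) (s : Q →+* Q)
    (h : ∀ t, p (σ t) = s (p t)) : Function.Injective p := by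
  let s' : Q →ₐ[constants K] Q :=
    { s with
      commutes' := fun c => by
        change s (algebraMap K Q c) = algebraMap K Q c
        rw [← AlgHom.commutes p, ← h, Extension.σ_algebraMap, mem_constants.1 c.2] }
  let τ : Q ⊗[constants K] F →ₐ[constants K] Q ⊗[constants K] F :=
    Algebra.TensorProduct.map s' (AlgHom.id (constants K) F)
  let π : T ⊗[constants K] F →ₐ[K] Q ⊗[constants K] F :=
    Algebra.TensorProduct.map p (AlgHom.id (constants K) F)
  have hπ : ∀ t c, π (t ⊗ₜ c) = p t ⊗ₜ c := fun t c => by simp [π]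
  have hπτ : ∀ x, π (σExt K T F x) = τ (π x) := fun x => by
    induction x with
    | zero => simp
    | add x y hx hy => simp only [map_add, hx, hy]
    | tmul t c =>
      rw [σExt_tmul, hπ, hπ, h]
      simp [τ, s']
  have hinj := injective_of_equivariant_baseChange hK hs hc
    (τ : Q ⊗[constants K] F →+* Q ⊗[constants K] F)
    ((π.comp (Φ : _ →ₐ[K] T ⊗[constants K] F) :
      BaseChange k K R ⊗[constants K] F →ₐ[K] Q ⊗[constants K] F) :
      BaseChange k K R ⊗[constants K] F →+* Q ⊗[constants K] F)
    (fun x => by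
      change π (Φ (σExt K (BaseChange k K R) F x)) = τ (π (Φ x))
      rw [hΦσ, hπτ]) fun b hb => eq_zero_of_one_tmul_eq_zero (K := K) (M := Q) (by
      have hb' : π (Φ (1 ⊗ₜ b)) = 0 := hb
      rwa [hΦ, hπ, map_one] at hb')
  rw [injective_iff_map_eq_zero]
  intro t ht
  have h0 : Φ.symm (t ⊗ₜ 1) = 0 := hinj (by
    change π (Φ (Φ.symm (t ⊗ₜ 1))) = π (Φ 0)
    rw [AlgEquiv.apply_symm_apply, hπ, ht, TensorProduct.zero_tmul, map_zero, map_zero])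
  rw [AlgEquiv.symm_apply_eq, map_zero] at h0
  exact Algebra.TensorProduct.includeLeft_injective (S := constants K) (R := constants K)
    (A := T) (B := F) (algebraMap (constants K) F).injective (by
      rw [map_zero]
      exact h0)

/-- The quotient by a proper invariant ideal is a nonzero equivariant image of `T`, so the quotient
map is injective. -/
theorem isSimple_of_equiv_tensor [Nontrivial T]
    (hK : IntermediateField.adjoin k (constants K : Set K) = ⊤)
    (hs : IsSimple R) (hc : NoNewConstants k R) (hΦ : ∀ c : F, Φ (1 ⊗ₜ c) = 1 ⊗ₜ c)
    (hΦσ : ∀ x, Φ (σExt K (BaseChange k K R) F x) = σExt K T F (Φ x)) : IsSimple T := by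
  refine ⟨inferInstance, fun I hI => or_iff_not_imp_right.2 fun hI' => ?_⟩
  have : Nontrivial (T ⧸ I) := Ideal.Quotient.nontrivial_iff.2 hI'
  have hinj := injective_of_equiv_tensor Φ hK hs hc hΦ hΦσ (Ideal.Quotient.mkₐ K I)
    (Ideal.quotientMap I ((σ : T ≃+* T) : T →+* T) hI) fun t => rfl
  rw [← Ideal.Quotient.mkₐ_ker K I]
  exact (RingHom.injective_iff_ker_eq_bot _).1 hinj

/-! ### The embedding of `R ⊗_{C_k} B` in `T ⊗_{C_K} B` -/

section Compare

variable {B B' : Type u} [CommRing B] [Algebra (constants k) B] [Algebra (constants K) B]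
  [IsScalarTower (constants k) (constants K) B] [CommRing B'] [Algebra (constants k) B']
  [Algebra (constants K) B'] [IsScalarTower (constants k) (constants K) B']
  (f : F →ₐ[constants K] B)

/-- The homomorphism `K ⊗_k R → T ⊗_{C_K} B` defined by `Φ` and `f : F → B`. -/
noncomputable def solutionHom : BaseChange k K R →ₐ[K] T ⊗[constants K] B :=
  (tensorMap T f).comp ((Φ : _ →ₐ[K] T ⊗[constants K] F).comp (inclLeft K (BaseChange k K R) F))

theorem solutionHom_apply (s : BaseChange k K R) :
    solutionHom Φ f s = tensorMap T f (Φ (s ⊗ₜ 1)) := rfl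

/-- The homomorphism `R ⊗_{C_k} B → T ⊗_{C_K} B` defined by `Φ` and `f : F → B`. -/
noncomputable def compareHom : R ⊗[constants k] B →+* T ⊗[constants K] B :=
  (linearExtend (solutionHom Φ f) : BaseChange k K R ⊗[constants K] B →+* _).comp
    (constExtHom k K R B)

theorem compareHom_tmul (r : R) (b : B) :
    compareHom Φ f (r ⊗ₜ b) = solutionHom Φ f (BaseChange.mk k 1 r) * (1 ⊗ₜ b) := by
  change linearExtend (solutionHom Φ f) (constExtHom k K R B (r ⊗ₜ b)) = _
  rw [constExtHom_tmul, linearExtend_tmul]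

theorem compareHom_tmul_one (r : R) :
    compareHom Φ f (r ⊗ₜ 1) = solutionHom Φ f (BaseChange.mk k 1 r) := by
  rw [compareHom_tmul, ← Algebra.TensorProduct.one_def, mul_one]

theorem compareHom_one_tmul (b : B) : compareHom Φ f (1 ⊗ₜ b) = 1 ⊗ₜ b := by
  rw [compareHom_tmul]
  change solutionHom Φ f 1 * _ = _
  rw [map_one, one_mul]

theorem compareHom_algebraMap (a : k) :
    compareHom Φ f (algebraMap k _ a) = algebraMap K _ (algebraMap k K a) := by
  rw [Algebra.TensorProduct.algebraMap_apply, compareHom_tmul_one, ← BaseChange.incl_apply,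
    BaseChange.incl_algebraMap, AlgHom.commutes]

theorem compareHom_tensorMap (g : B →ₐ[constants k] B') (g' : B →ₐ[constants K] B')
    (hg : ∀ b, g b = g' b) (x : R ⊗[constants k] B) :
    compareHom Φ (g'.comp f) (tensorMap R g x) = tensorMap T g' (compareHom Φ f x) := by
  have hc : ∀ y : T ⊗[constants K] F,
      tensorMap T (g'.comp f) y = tensorMap T g' (tensorMap T f y) := fun y => by
    induction y with
    | zero => simp
    | add x y hx hy => rw [map_add, map_add, map_add, hx, hy]
    | tmul r b => simp [tensorMap]
  induction x with
  | zero => simp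
  | add x y hx hy => simp only [map_add, hx, hy]
  | tmul r b =>
    have h1 : tensorMap R g (r ⊗ₜ b) = r ⊗ₜ g b := by simp [tensorMap]
    have h2 : tensorMap T g' ((1 : T) ⊗ₜ b) = 1 ⊗ₜ g' b := by simp [tensorMap]
    rw [h1, compareHom_tmul, compareHom_tmul, map_mul, h2, hg, solutionHom_apply,
      solutionHom_apply, hc]

theorem solutionHom_σ (hΦσ : ∀ x, Φ (σExt K (BaseChange k K R) F x) = σExt K T F (Φ x))
    (s : BaseChange k K R) :
    solutionHom Φ f (σ s) = σExt K T B (solutionHom Φ f s) := by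
  rw [solutionHom_apply, solutionHom_apply, ← tensorMap_σExt, ← hΦσ, σExt_tmul]

theorem compareHom_σExt (hΦσ : ∀ x, Φ (σExt K (BaseChange k K R) F x) = σExt K T F (Φ x))
    (x : R ⊗[constants k] B) :
    compareHom Φ f (σExt k R B x) = σExt K T B (compareHom Φ f x) := by
  change linearExtend (solutionHom Φ f) (constExtHom k K R B _) = σExt K T B
    (linearExtend (solutionHom Φ f) (constExtHom k K R B x))
  rw [constExtHom_σExt, linearExtend_σExt _ (solutionHom_σ Φ f hΦσ)]

theorem compareHom_injective [Nontrivial T]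
    (hΦσ : ∀ x, Φ (σExt K (BaseChange k K R) F x) = σExt K T F (Φ x)) (hs : IsSimple R) (hc : NoNewConstants k R) :
    Function.Injective (compareHom Φ f) :=
  comp_constExtHom_injective hs hc (σExt K T B : T ⊗[constants K] B →+* T ⊗[constants K] B)
    (linearExtend (solutionHom Φ f) : BaseChange k K R ⊗[constants K] B →+* T ⊗[constants K] B)
    (linearExtend_σExt _ (solutionHom_σ Φ f hΦσ)) fun b hb =>
      eq_zero_of_one_tmul_eq_zero (K := K) (M := T) (by
        rw [← linearExtend_one_tmul (solutionHom Φ f)]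
        exact hb)

end Compare
end Comparison

/-! ### Comparison of the Galois groups -/

section GaloisComparison

variable {k K R T : Type u} [Field k] [DifferenceRing k] [Field K] [DifferenceRing K] [Algebra k K]
  [Extension k K] [CommRing R] [DifferenceRing R] [Algebra k R] [Extension k R]
  [CommRing T] [DifferenceRing T] [Algebra K T] [Extension K T] {n : ℕ} {A : GL (Fin n) k}
  {F : Type u} [Field F] [Algebra (constants k) F] [Algebra (constants K) F]
  [IsScalarTower (constants k) (constants K) F]
  (Φ : BaseChange k K R ⊗[constants K] F ≃ₐ[K] T ⊗[constants K] F)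
  {B : Type u} [CommRing B] [Algebra (constants k) B] [Algebra (constants K) B]
  [IsScalarTower (constants k) (constants K) B] (f : F →ₐ[constants K] B)

/-- The restriction of `φ` to `R`, followed by the embedding, is extended linearly over `K` and then
over `F`, and transported by `Φ⁻¹` to an equivariant homomorphism `T → T ⊗ B`. Simplicity of `T`
turns this into an automorphism. -/
theorem exists_galoisPoint_right (hΦ : ∀ c : F, Φ (1 ⊗ₜ c) = 1 ⊗ₜ c)
    (hΦσ : ∀ x, Φ (σExt K (BaseChange k K R) F x) = σExt K T F (Φ x))
    (V : FundamentalMatrix (Matrix.GeneralLinearGroup.map (algebraMap k K) A) T) (hV : V.ring = ⊤)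
    (hsT : IsSimple T) (hcT : NoNewConstants K T) (φ : galoisPoints k R B) :
    ∃ θ : galoisPoints K T B, ∀ x, θ.1 (compareHom Φ f x) = compareHom Φ f (φ.1 x) := by
  let g : R →+* T ⊗[constants K] B := (compareHom Φ f).comp
    ((φ.1 : R ⊗[constants k] B →+* R ⊗[constants k] B).comp
      (inclLeft k R B : R →+* R ⊗[constants k] B))
  have hg : ∀ a, g (algebraMap k R a) = algebraMap K _ (algebraMap k K a) := fun a => by
    change compareHom Φ f (φ.1 (algebraMap k _ a)) = _
    rw [AlgEquiv.commutes, compareHom_algebraMap]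
  have hgσ : ∀ r, g (σ r) = σExt K T B (g r) := fun r => by
    change compareHom Φ f (φ.1 (σExt k R B (r ⊗ₜ 1))) = _
    rw [φ.2.2, compareHom_σExt Φ f hΦσ]
    rfl
  let g₁ := BaseChange.lift g hg
  have hg₁ : ∀ s, g₁ (σ s) = σExt K T B (g₁ s) :=
    BaseChange.lift_σ g hg (σExt K T B : T ⊗[constants K] B →+* T ⊗[constants K] B)
      (fun a => by
        change σExt K T B ((algebraMap K T a) ⊗ₜ 1) = (algebraMap K T (σ a)) ⊗ₜ 1
        rw [σExt_tmul, Extension.σ_algebraMap]) hgσ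
  let g₂ : BaseChange k K R ⊗[constants K] F →ₐ[K] T ⊗[constants K] B :=
    (linearExtend g₁).comp (tensorMap (BaseChange k K R) f)
  have hg₂ : ∀ x, g₂ (σExt K _ F x) = σExt K T B (g₂ x) := fun x => by
    change linearExtend g₁ (tensorMap _ f _) = σExt K T B (linearExtend g₁ (tensorMap _ f x))
    rw [tensorMap_σExt, linearExtend_σExt g₁ hg₁]
  have hg₂' : ∀ c : F, g₂ (1 ⊗ₜ c) = 1 ⊗ₜ f c := fun c => by
    change linearExtend g₁ (tensorMap _ f ((1 : BaseChange k K R) ⊗ₜ[constants K] c)) = _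
    have : tensorMap (BaseChange k K R) f (1 ⊗ₜ c) = 1 ⊗ₜ f c := by simp [tensorMap]
    rw [this, linearExtend_one_tmul]
  obtain ⟨θ, hθ⟩ := exists_galoisPoint V hV hsT hcT
    ((g₂.comp (Φ.symm : _ →ₐ[K] BaseChange k K R ⊗[constants K] F)).comp (inclLeft K T F))
    fun t => by
      change g₂ (Φ.symm (σExt K T F (t ⊗ₜ 1))) = σExt K T B (g₂ (Φ.symm (t ⊗ₜ 1)))
      rw [← hg₂]
      congr 1
      rw [AlgEquiv.symm_apply_eq, hΦσ, AlgEquiv.apply_symm_apply]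
  have hη : ∀ y, θ.1 (tensorMap T f y) = g₂ (Φ.symm y) := by
    have : (θ.1 : T ⊗[constants K] B →ₐ[K] _).comp (tensorMap T f) =
        g₂.comp (Φ.symm : _ →ₐ[K] BaseChange k K R ⊗[constants K] F) := by
      refine tensorMap_ext (fun t => ?_) fun c => ?_
      · change θ.1 (tensorMap T f (t ⊗ₜ 1)) = _
        have : tensorMap T f (t ⊗ₜ 1) = t ⊗ₜ 1 := by simp [tensorMap]
        rw [this, hθ]
        rfl
      · change θ.1 (tensorMap T f (1 ⊗ₜ c)) = g₂ (Φ.symm (1 ⊗ₜ c))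
        have : tensorMap T f (1 ⊗ₜ c) = 1 ⊗ₜ f c := by simp [tensorMap]
        rw [this, θ.2.1, ← hΦ, AlgEquiv.symm_apply_apply, hg₂']
    exact fun y => DFunLike.congr_fun this y
  refine ⟨θ, fun x => ?_⟩
  induction x with
  | zero => simp
  | add x y hx hy => simp only [map_add, hx, hy]
  | tmul r b =>
    have h1 : g₂ (BaseChange.mk k 1 r ⊗ₜ 1) = g r := by
      change linearExtend g₁ (tensorMap _ f (BaseChange.mk k (1 : K) r ⊗ₜ[constants K] (1 : F))) = _
      have : tensorMap (BaseChange k K R) f (BaseChange.mk k 1 r ⊗ₜ 1) =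
        BaseChange.mk k 1 r ⊗ₜ 1 := by simp [tensorMap]
      rw [this, linearExtend_tmul_one, BaseChange.lift_mk, map_one, one_mul]
    rw [compareHom_tmul, map_mul, θ.2.1, solutionHom_apply, hη, AlgEquiv.symm_apply_apply, h1,
      tmul_eq r b, map_mul, φ.2.1, map_mul, compareHom_one_tmul]
    rfl

/-- The automorphism `θ` moves the image of `Z` by a right factor in `GL_n(B)`, so it maps the image
of `R ⊗ B` into itself and restricts there. -/
theorem exists_galoisPoint_left
    (hΦσ : ∀ x, Φ (σExt K (BaseChange k K R) F x) = σExt K T F (Φ x))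
    (Z : FundamentalMatrix A R) (hZ : Z.ring = ⊤) (hs : IsSimple R) (hc : NoNewConstants k R)
    (V : FundamentalMatrix (Matrix.GeneralLinearGroup.map (algebraMap k K) A) T) [Nontrivial T]
    (hcT : NoNewConstants K T) (θ : galoisPoints K T B) :
    ∃ φ : galoisPoints k R B, ∀ x, θ.1 (compareHom Φ f x) = compareHom Φ f (φ.1 x) := by
  have hinj := compareHom_injective Φ f hΦσ hs hc
  let ρ := solutionHom Φ f
  let ρ' : BaseChange k K R →ₐ[K] T ⊗[constants K] B :=
    (θ.1 : T ⊗[constants K] B →ₐ[K] T ⊗[constants K] B).comp ρ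
  have hρ : ∀ s, ρ (σ s) = σExt K T B (ρ s) := solutionHom_σ Φ f hΦσ
  obtain ⟨P, hP⟩ := exists_glMap_eq_mul (Z.baseChange K) V hcT ρ hρ
  obtain ⟨P', hP'⟩ := exists_glMap_eq_mul (Z.baseChange K) V hcT ρ' fun s => by
    change θ.1 (ρ (σ s)) = σExt K T B (θ.1 (ρ s))
    rw [hρ, θ.2.2]
  have hmem : ∀ r, (ρ' : _ →+* T ⊗[constants K] B).comp (BaseChange.incl k K R) r ∈
      (compareHom Φ f).range := by
    refine Z.apply_mem hZ _ (fun a => ⟨algebraMap k _ a, ?_⟩) ?_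
    · rw [compareHom_algebraMap, RingHom.comp_apply, BaseChange.incl_algebraMap]
      exact (ρ'.commutes _).symm
    -- The images of `Z` under `ρ` and under `θ ∘ ρ` are `V P` and `V P'`, so the second is the
    -- first times `P⁻¹ P'`; both factors have entries in the range.
    · have h : Matrix.GeneralLinearGroup.map
          ((ρ' : _ →+* T ⊗[constants K] B).comp (BaseChange.incl k K R)) Z.mat =
          Matrix.GeneralLinearGroup.map
            ((ρ : _ →+* T ⊗[constants K] B).comp (BaseChange.incl k K R)) Z.mat *
          Matrix.GeneralLinearGroup.map (inclRight K T B : B →+* T ⊗[constants K] B)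
            (P⁻¹ * P') := by
        rw [← mul_inv_eq_iff_eq_mul] at hP
        rw [← hP, mul_assoc, ← map_inv, ← map_mul] at hP'
        exact hP'
      rw [h]
      refine mul_mem (map_mem_glSubgroup (X := (compareHom Φ f).range) _
        (fun r => ⟨r ⊗ₜ 1, ?_⟩) _) (map_mem_glSubgroup (X := (compareHom Φ f).range) _
          (fun b => ⟨1 ⊗ₜ b, compareHom_one_tmul Φ f b⟩) _)
      rw [compareHom_tmul_one]
      rfl
  -- Injectivity of `compareHom` makes the chosen preimages unique, so `p` inherits additivity,
  -- multiplicativity, `k`-linearity and equivariance.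
  choose p hp using hmem
  have hp' : ∀ r, compareHom Φ f (p r) = θ.1 (compareHom Φ f (r ⊗ₜ 1)) := fun r => by
    rw [hp, compareHom_tmul_one]
    rfl
  let pHom : R →ₐ[k] R ⊗[constants k] B :=
    { toFun := p
      map_one' := hinj (by rw [hp', ← Algebra.TensorProduct.one_def, map_one, map_one])
      map_mul' := fun r s => hinj (by
        have : (r * s) ⊗ₜ[constants k] (1 : B) = (r ⊗ₜ 1) * (s ⊗ₜ 1) := by simp
        rw [map_mul, hp', hp', hp', this, map_mul, map_mul])
      map_zero' := hinj (by rw [hp', TensorProduct.zero_tmul, map_zero, map_zero])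
      map_add' := fun r s => hinj (by
        rw [map_add, hp', hp', hp', TensorProduct.add_tmul, map_add, map_add])
      commutes' := fun a => hinj (by
        rw [hp']
        change θ.1 (compareHom Φ f (algebraMap k _ a)) = _
        rw [compareHom_algebraMap, AlgEquiv.commutes]) }
  obtain ⟨φ, hφ⟩ := exists_galoisPoint Z hZ hs hc pHom fun r => hinj (by
    change compareHom Φ f (p (σ r)) = compareHom Φ f (σExt k R B (p r))
    rw [hp', compareHom_σExt Φ f hΦσ, hp', ← θ.2.2, ← compareHom_σExt Φ f hΦσ, σExt_tmul])
  refine ⟨φ, fun x => ?_⟩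
  induction x with
  | zero => simp
  | add x y hx hy => simp only [map_add, hx, hy]
  | tmul r b =>
    rw [tmul_eq r b, map_mul, map_mul, map_mul, map_mul, compareHom_one_tmul, θ.2.1, φ.2.1,
      compareHom_one_tmul, hφ, ← hp']
    rfl

/-- The image of `R` together with `K` and `B` generates `T ⊗ B`, and both automorphisms are linear
over `K` and `B`. -/
theorem galoisPoint_right_unique
    (hΦσ : ∀ x, Φ (σExt K (BaseChange k K R) F x) = σExt K T F (Φ x))
    (Z : FundamentalMatrix A R)
    (V : FundamentalMatrix (Matrix.GeneralLinearGroup.map (algebraMap k K) A) T) (hV : V.ring = ⊤)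
    [Nontrivial T] (hcT : NoNewConstants K T) {θ η : galoisPoints K T B}
    (h : ∀ x, θ.1 (compareHom Φ f x) = η.1 (compareHom Φ f x)) : θ = η := by
  have htop := eq_top_of_range_le (Z.baseChange K) V hV hcT (solutionHom Φ f)
    (solutionHom_σ Φ f hΦσ) (AlgHom.equalizer
      (θ.1 : T ⊗[constants K] B →ₐ[K] T ⊗[constants K] B)
      (η.1 : T ⊗[constants K] B →ₐ[K] T ⊗[constants K] B)) (fun s => ?_) fun b => ?_
  · refine Subtype.ext (AlgEquiv.ext fun x => ?_)
    have hx := htop.ge (Algebra.mem_top (x := x))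
    exact hx
  · change θ.1 (solutionHom Φ f s) = η.1 (solutionHom Φ f s)
    induction s using BaseChange.induction with
    | zero => simp
    | add x y hx hy => simp only [map_add, hx, hy]
    | mk a r =>
      rw [BaseChange.mk_eq, map_mul, AlgHom.commutes, map_mul, map_mul, AlgEquiv.commutes,
        AlgEquiv.commutes, ← compareHom_tmul_one, h]
  · change θ.1 (1 ⊗ₜ b) = η.1 (1 ⊗ₜ b)
    rw [θ.2.1, η.2.1]

/-- The isomorphism of the `B`-points of the Galois groups of `R` and of `T`. -/
theorem exists_galoisPoints_mulEquiv (hΦ : ∀ c : F, Φ (1 ⊗ₜ c) = 1 ⊗ₜ c)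
    (hΦσ : ∀ x, Φ (σExt K (BaseChange k K R) F x) = σExt K T F (Φ x))
    (Z : FundamentalMatrix A R) (hZ : Z.ring = ⊤) (hs : IsSimple R) (hc : NoNewConstants k R)
    (V : FundamentalMatrix (Matrix.GeneralLinearGroup.map (algebraMap k K) A) T) (hV : V.ring = ⊤)
    (hsT : IsSimple T) (hcT : NoNewConstants K T) :
    ∃ e : galoisPoints k R B ≃* galoisPoints K T B,
      ∀ φ x, (e φ).1 (compareHom Φ f x) = compareHom Φ f (φ.1 x) := by
  have := hsT.1
  choose e he using exists_galoisPoint_right Φ f hΦ hΦσ V hV hsT hcT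
  have huniq : ∀ {θ η : galoisPoints K T B},
      (∀ x, θ.1 (compareHom Φ f x) = η.1 (compareHom Φ f x)) → θ = η :=
    galoisPoint_right_unique Φ f hΦσ Z V hV hcT
  refine ⟨MulEquiv.ofBijective (⟨⟨e, huniq fun x => he 1 x⟩, fun φ ψ => huniq fun x => ?_⟩ : _ →* _)
    ⟨fun φ ψ h => ?_, fun θ => ?_⟩, he⟩
  · change (e (φ * ψ)).1 _ = (e φ).1 ((e ψ).1 _)
    rw [he, he, he]
    rfl
  · refine Subtype.ext (AlgEquiv.ext fun x => compareHom_injective Φ f hΦσ hs hc ?_)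
    rw [← he, ← he]
    exact congrArg (fun θ : galoisPoints K T B => θ.1 (compareHom Φ f x)) h
  · obtain ⟨φ, hφ⟩ := exists_galoisPoint_left Φ f hΦσ Z hZ hs hc V hcT θ
    exact ⟨φ, huniq fun x => (he φ x).trans (hφ x).symm⟩

/-- The relation between `φ` and `θ` survives base change. With uniqueness of the extension, this is
naturality in `B`. -/
theorem galoisMap_compareHom {B' : Type u} [CommRing B'] [Algebra (constants k) B']
    [Algebra (constants K) B'] [IsScalarTower (constants k) (constants K) B']
    (g : B →ₐ[constants k] B') (g' : B →ₐ[constants K] B') (hg : ∀ b, g b = g' b)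
    (φ : galoisPoints k R B) (θ : galoisPoints K T B)
    (h : ∀ x, θ.1 (compareHom Φ f x) = compareHom Φ f (φ.1 x)) (x : R ⊗[constants k] B') :
    (galoisMap g' θ).1 (compareHom Φ (g'.comp f) x) =
      compareHom Φ (g'.comp f) ((galoisMap g φ).1 x) := by
  have hx := compareHom_tensorMap (R := R) Φ f g g' hg
  induction x with
  | zero => simp
  | add x y hx hy => simp only [map_add, hx, hy]
  | tmul r b =>
    have h1 : tensorMap R g (r ⊗ₜ 1) = r ⊗ₜ 1 := by simp [tensorMap]
    have h2 : ∀ y, (galoisMap g' θ).1 (tensorMap T g' y) = tensorMap T g' (θ.1 y) :=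
      extendHom_tensorMap g' θ
    rw [tmul_eq r b, map_mul, map_mul, map_mul, map_mul, (galoisMap g φ).2.1, compareHom_one_tmul,
      (galoisMap g' θ).2.1, galoisMap_tmul_one, hx, ← h, ← h2, ← hx, h1]

theorem nonempty_groupBaseChange_iso (hΦ : ∀ c : F, Φ (1 ⊗ₜ c) = 1 ⊗ₜ c)
    (hΦσ : ∀ x, Φ (σExt K (BaseChange k K R) F x) = σExt K T F (Φ x))
    (Z : FundamentalMatrix A R) (hZ : Z.ring = ⊤) (hs : IsSimple R) (hc : NoNewConstants k R)
    (V : FundamentalMatrix (Matrix.GeneralLinearGroup.map (algebraMap k K) A) T) (hV : V.ring = ⊤)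
    (hsT : IsSimple T) (hcT : NoNewConstants K T) :
    Nonempty (groupBaseChange F (galoisGroup k R) ≅ groupBaseChange F (galoisGroup K T)) := by
  have := hsT.1
  -- These structures are the ones `restrictAlg` puts on `B`, so the points of the base-changed
  -- functors are literally those compared above.
  let algk (B : CommAlgCat.{u} F) : Algebra (constants k) B :=
    Algebra.compHom B (algebraMap (constants k) F)
  let algK (B : CommAlgCat.{u} F) : Algebra (constants K) B :=
    Algebra.compHom B (algebraMap (constants K) F)
  have tower (B : CommAlgCat.{u} F) : IsScalarTower (constants k) (constants K) B :=
    IsScalarTower.of_algebraMap_eq fun c => congrArg (algebraMap F B)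
      (IsScalarTower.algebraMap_apply (constants k) (constants K) F c)
  let f (B : CommAlgCat.{u} F) : F →ₐ[constants K] B :=
    { algebraMap F B with commutes' := fun _ => rfl }
  choose e he using fun B : CommAlgCat.{u} F =>
    exists_galoisPoints_mulEquiv Φ (f B) hΦ hΦσ Z hZ hs hc V hV hsT hcT
  refine ⟨NatIso.ofComponents (fun B => (e B).toGrpIso) fun {B B'} h => ?_⟩
  let hk : B →ₐ[constants k] B' := ((restrictAlg (constants k) F).map h).hom
  let hK : B →ₐ[constants K] B' := ((restrictAlg (constants K) F).map h).hom
  have hf : hK.comp (f B) = f B' := AlgHom.ext fun c => h.hom.commutes c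
  refine GrpCat.hom_ext (MonoidHom.ext fun φ => ?_)
  change e B' (galoisMap hk φ) = galoisMap hK (e B φ)
  refine galoisPoint_right_unique Φ (f B') hΦσ Z V hV hcT fun x => ?_
  rw [he, ← hf]
  exact (galoisMap_compareHom Φ (f B) hk hK (fun _ => rfl) φ (e B φ) (he B φ) x).symm

end GaloisComparison

end DifferenceRing
theorem theorem2p9
    {k : Type u} [Field k] [CharZero k] [DifferenceRing k] [IsAlgClosed (constants k)]
    {n : ℕ} (A : GL (Fin n) k)
    (R : Type u) [CommRing R] [DifferenceRing R] [Algebra k R] [Extension k R]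
    (hR : IsPicardVessiotRing A R)
    (K : Type u) [Field K] [DifferenceRing K] [Algebra k K] [Extension k K]
    (hK : IntermediateField.adjoin k (constants K : Set K) = ⊤)
    (L : Type u) [Field L] [DifferenceRing L] [Algebra K L] [Extension K L]
    (hL : IsWeakPicardVessiotField (Matrix.GeneralLinearGroup.map (algebraMap k K) A) L)
    (V : FundamentalMatrix (Matrix.GeneralLinearGroup.map (algebraMap k K) A) L)
    (hV : IntermediateField.adjoin K
      (Set.range fun p : Fin n × Fin n => V.mat p.1 p.2) = ⊤)
    (F : Type u) [Field F] [Algebra (constants K) F] [IsAlgClosure (constants K) F]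
    [Algebra (constants k) F] [IsScalarTower (constants k) (constants K) F] :
    (∃ Φ : BaseChange k K R ⊗[constants K] F ≃ₐ[K] V.ring ⊗[constants K] F,
      (∀ c : F, Φ (1 ⊗ₜ c) = 1 ⊗ₜ c) ∧
      (∀ x, Φ (σExt K (BaseChange k K R) F x) = σExt K V.ring F (Φ x)) ∧
      ∃ ι : R ⊗[constants k] F →+* V.ring ⊗[constants K] F,
        Function.Injective ι ∧
          ∀ (r : R) (c : F), ι (r ⊗ₜ c) = Φ (BaseChange.mk k 1 r ⊗ₜ c)) ∧
    IsPicardVessiotRing (Matrix.GeneralLinearGroup.map (algebraMap k K) A) V.ring ∧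
    IsLinearAlgebraicGroup (galoisGroup k R) ∧
    IsLinearAlgebraicGroup (galoisGroup K V.ring) ∧
    Nonempty (groupBaseChange F (galoisGroup k R) ≅
      groupBaseChange F (galoisGroup K V.ring)) := by
  obtain ⟨⟨Z, hZ⟩, hs⟩ := hR
  have : Algebra.FiniteType k R := Z.finiteType hZ
  have hc : NoNewConstants k R := noNewConstants_of_isSimple hs
  obtain ⟨V', hV'⟩ := V.exists_ring_eq_top
  have hcT : NoNewConstants K V.ring := V.noNewConstants_ring hL.1
  have : IsAlgClosed F := IsAlgClosure.isAlgClosed (constants K)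
  -- The field `L` is the simple overring of `T` without new constants. Simplicity of `T` itself is
  -- then deduced from `Φ`.
  obtain ⟨Φ, hΦ, hΦσ⟩ := exists_equiv_tensor (F := F) hK Z hZ hs hc V' hV' hcT V.ring.val
    Subtype.val_injective (fun _ => rfl) (isSimple_of_field L) hL.1
  have hsT : IsSimple V.ring := isSimple_of_equiv_tensor Φ hK hs hc hΦ hΦσ
  refine ⟨⟨Φ, hΦ, hΦσ, (Φ : BaseChange k K R ⊗[constants K] F →+* V.ring ⊗[constants K] F).comp
      (constExtHom k K R F),
    comp_constExtHom_injective hs hc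
      (σExt K V.ring F : V.ring ⊗[constants K] F →+* V.ring ⊗[constants K] F)
      (Φ : BaseChange k K R ⊗[constants K] F →+* V.ring ⊗[constants K] F) hΦσ fun b hb => ?_, fun r c => ?_⟩,
    ⟨⟨V', hV'⟩, hsT⟩, isLinearAlgebraicGroup_galoisGroup Z hZ hs hc,
    isLinearAlgebraicGroup_galoisGroup V' hV' hsT hcT,
    nonempty_groupBaseChange_iso Φ hΦ hΦσ Z hZ hs hc V' hV' hsT hcT⟩
  · refine eq_zero_of_one_tmul_eq_zero (K := K) (M := V.ring) ?_
    rw [← hΦ]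
    exact hb
  · rw [RingHom.comp_apply, constExtHom_tmul]
    rfl
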